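/- Let $\Bbbk$ be a field of characteristic $p\ge 3$. A \emph{Poisson algebra} is a commutative (associative, unital) $\Bbbk$-algebra $A$ with a $\Bbbk$-bilinear Lie bracket $\{-,-\}$ satisfying $\{xy,z\}=x\{y,z\}+y\{x,z\}$. Write $\mathrm{ad}_x=\{x,-\}$. A \emph{restricted Poisson structure} on $A$ is a map $x\mapsto x^{\{p\}}$, $A\to A$, such that for all $x,y\in A$ and $\lambda\in\Bbbk$ $$\mathrm{ad}_x^p=\mathrm{ad}_{x^{\{p\}}},\qquad (\lambda x)^{\{p\}}=\lambda^p x^{\{p\}},\qquad (x+y)^{\{p\}}=x^{\{p\}}+y^{\{p\}}+\sum_{i=1}^{p-1}\frac{s_i(x,y)}{i},\qquad (x^2)^{\{p\}}=2x^p\,x^{\{p\}},$$ where $s_i(x,y)$ is the coefficient of $t^{i-1}$ in $\mathrm{ad}_{tx+y}^{p-1}(x)$. A Poisson algebra with such a map is a \emph{restricted Poisson algebra}; a morphism is a unital algebra homomorphism preserving the bracket and the $p$-map. For Poisson algebras $A,B$ the algebra $A\otimes B=A\otimes_\Bbbk B$ carries the Poisson bracket $\{a_1\otimes b_1,a_2\otimes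 b_2\}=\{a_1,a_2\}\otimes b_1b_2+a_1a_2\otimes\{b_1,b_2\}$. **Proposition 9.2.** 1. For restricted Poisson algebras $A$ and $B$ there is a unique restricted Poisson structure on the Poisson algebra $A\otimes B$ such that $$(a\otimes b)^{\{p\}}=a^{\{p\}}\otimes b^p+a^p\otimes b^{\{p\}}\qquad\text{for all } a\in A,\ b\in B.$$ 2. With this tensor product, restricted Poisson algebras over $\Bbbk$ and their morphisms form a symmetric monoidal category. More precisely, there is a symmetric monoidal structure on this category for which the forgetful functor to commutative $\Bbbk$-algebras (with $\otimes_\Bbbk$, unit $\Bbbk$ and the usual symmetry) is a braided strong monoidal functor, and for which the algebra isomorphism from $A\otimes_\Bbbk B$ to the underlying algebra of the product of $A$ and $B$ is a morphism of restricted Poisson algebras when $A\otimes_\Bbbk B$ carries the structure in part 1. 3. Consequently the following notion is well defined. Let $H$ be a restricted Poisson algebra that is also a Hopf algebra over $\Bbbk$ (on the same algebra), with comultiplication $\Delta$, counit $\epsilon$ and antipode $S$. Then $H$ is a \emph{restricted Poisson Hopf algebra} if $\Delta:H\to H\otimes H$ is a morphism of restricted Poisson algebras for some restricted Poisson structure on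 $H\otimes H$ satisfying the formula in part 1; $\epsilon:H\to\Bbbk$ is a morphism of restricted Poisson algebras, where $\Bbbk$ has zero bracket and zero $p$-map; and $S$ is an anti-automorphism, that is, a bijective linear map with $S(1)=1$, $S(xy)=S(y)S(x)$, $S(\{x,y\})=\{S(y),S(x)\}$ and $S(x^{\{p\}})=S(x)^{\{p\}}$. For every such $H$ there is exactly one structure as in part 1 on $H\otimes H$ for which $H$ is a restricted Poisson Hopf algebra if and only if $\Delta$ is a morphism for this structure and $\epsilon$ and $S$ are as stated. -/

import Mathlib

open CategoryTheory MonoidalCategory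
open scoped TensorProduct Polynomial

universe u v w

/-- A Poisson structure on a commutative `K`-algebra `A`: a `K`-bilinear Lie bracket satisfying the
Leibniz rule. The bracket is not expressed through Mathlib's `LieRing A`, because every
ring already carries a `LieRing` instance given by the commutator. -/
class PoissonAlgebra (K : Type u) (A : Type v) [CommRing K] [CommRing A] [Algebra K A] where
  /-- The Poisson bracket `{x, y}`; `bracket x` is the adjoint operator `ad_x`. -/
  bracket : A →ₗ[K] A →ₗ[K] A
  bracket_self : ∀ x, bracket x x = 0
  jacobi : ∀ x y z,
    bracket x (bracket y z) + bracket y (bracket z x) + bracket z (bracket x y) = 0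
  leibniz : ∀ x y z, bracket (x * y) z = x * bracket y z + y * bracket x z

namespace PoissonAlgebra

section Tensor

variable (K : Type u) (A : Type v) (B : Type w) [CommRing K]
  [CommRing A] [Algebra K A] [CommRing B] [Algebra K B] [PoissonAlgebra K A] [PoissonAlgebra K B]

/-- The bracket `{a₁ ⊗ b₁, a₂ ⊗ b₂} = {a₁, a₂} ⊗ b₁b₂ + a₁a₂ ⊗ {b₁, b₂}` on `A ⊗ B`. -/
noncomputable def tensorBracket : A ⊗[K] B →ₗ[K] A ⊗[K] B →ₗ[K] A ⊗[K] B :=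
  TensorProduct.map₂ (bracket (K := K) (A := A)) (LinearMap.mul K B) +
    TensorProduct.map₂ (LinearMap.mul K A) (bracket (K := K) (A := B))

variable {A B}

theorem bracket_skew (x y : A) : bracket (K := K) x y = - bracket (K := K) y x := by
  have h := bracket_self (K := K) (x + y)
  simp only [map_add, LinearMap.add_apply, bracket_self, zero_add, add_zero] at h
  exact eq_neg_of_add_eq_zero_right h

theorem leibniz_right (x y z : A) : bracket (K := K) x (y * z) =
    y * bracket (K := K) x z + z * bracket (K := K) x y := by
  rw [bracket_skew, leibniz, bracket_skew K x z, bracket_skew K x y]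
  ring

@[simp]
theorem tensorBracket_tmul (a a' : A) (b b' : B) :
    tensorBracket K A B (a ⊗ₜ b) (a' ⊗ₜ b') =
      bracket (K := K) a a' ⊗ₜ (b * b') + (a * a') ⊗ₜ bracket (K := K) b b' := by
  simp [tensorBracket]

theorem tensorBracket_skew (x y : A ⊗[K] B) :
    tensorBracket K A B x y + tensorBracket K A B y x = 0 := by
  induction x with
  | zero => simp
  | add x x' hx hx' =>
    simp only [map_add, LinearMap.add_apply]
    linear_combination hx + hx'
  | tmul a b =>
    induction y with
    | zero => simp
    | add y y' hy hy' =>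
      simp only [map_add, LinearMap.add_apply]
      linear_combination hy + hy'
    | tmul a' b' =>
      simp only [tensorBracket_tmul]
      rw [bracket_skew K a' a, bracket_skew K b' b, mul_comm a' a, mul_comm b' b,
        TensorProduct.neg_tmul, TensorProduct.tmul_neg]
      ring

theorem tensorBracket_self (x : A ⊗[K] B) : tensorBracket K A B x x = 0 := by
  induction x with
  | zero => simp
  | add x x' hx hx' =>
    simp only [map_add, LinearMap.add_apply]
    linear_combination hx + hx' + tensorBracket_skew K x x'
  | tmul a b => simp [bracket_self]

theorem tensorBracket_leibniz (x y z : A ⊗[K] B) :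
    tensorBracket K A B (x * y) z =
      x * tensorBracket K A B y z + y * tensorBracket K A B x z := by
  induction x with
  | zero => simp
  | add x x' hx hx' =>
    simp only [add_mul, map_add, LinearMap.add_apply, mul_add, hx, hx']
    ring
  | tmul a b =>
    induction y with
    | zero => simp
    | add y y' hy hy' =>
      simp only [add_mul, map_add, LinearMap.add_apply, mul_add, hy, hy']
      ring
    | tmul a' b' =>
      induction z with
      | zero => simp
      | add z z' hz hz' =>
        simp only [map_add, mul_add, hz, hz']
        ring
      | tmul a'' b'' =>
        simp only [tensorBracket_tmul, Algebra.TensorProduct.tmul_mul_tmul, leibniz, mul_add,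
          TensorProduct.add_tmul, TensorProduct.tmul_add]
        rw [show b * b' * b'' = b * (b' * b'') by ring,
          show b' * (b * b'') = b * (b' * b'') by ring,
          show a' * (a * a'') = a * (a' * a'') by ring,
          show a * a' * a'' = a * (a' * a'') by ring]
        abel

theorem tensorBracket_jacobi (x y z : A ⊗[K] B) :
    tensorBracket K A B x (tensorBracket K A B y z) +
      tensorBracket K A B y (tensorBracket K A B z x) +
      tensorBracket K A B z (tensorBracket K A B x y) = 0 := by
  induction x with
  | zero => simp
  | add x x' hx hx' =>
    simp only [map_add, LinearMap.add_apply]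
    linear_combination hx + hx'
  | tmul a b =>
    induction y with
    | zero => simp
    | add y y' hy hy' =>
      simp only [map_add, LinearMap.add_apply]
      linear_combination hy + hy'
    | tmul a' b' =>
      induction z with
      | zero => simp
      | add z z' hz hz' =>
        simp only [map_add, LinearMap.add_apply]
        linear_combination hz + hz'
      | tmul a'' b'' =>
        have ja := jacobi (K := K) a a' a''
        have jb := jacobi (K := K) b b' b''
        have ja' : bracket (K := K) a (bracket (K := K) a' a'') =
            - bracket (K := K) a' (bracket (K := K) a'' a)
            - bracket (K := K) a'' (bracket (K := K) a a') := by linear_combination ja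
        have jb' : bracket (K := K) b (bracket (K := K) b' b'') =
            - bracket (K := K) b' (bracket (K := K) b'' b)
            - bracket (K := K) b'' (bracket (K := K) b b') := by linear_combination jb
        simp only [tensorBracket_tmul, map_add, leibniz_right, ja', jb',
          TensorProduct.add_tmul, TensorProduct.tmul_add, TensorProduct.sub_tmul,
          TensorProduct.tmul_sub, TensorProduct.neg_tmul, TensorProduct.tmul_neg]
        rw [bracket_skew K a'' a, bracket_skew K a' a, bracket_skew K a'' a',
          bracket_skew K b'' b, bracket_skew K b' b, bracket_skew K b'' b']
        simp only [map_neg, mul_neg, TensorProduct.neg_tmul, TensorProduct.tmul_neg]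
        rw [show b'' * (b * b') = b * (b' * b'') by ring,
          show b' * (b'' * b) = b * (b' * b'') by ring,
          show a' * (a'' * a) = a * (a' * a'') by ring,
          show a'' * (a * a') = a * (a' * a'') by ring]
        abel

/-- The tensor product of two Poisson algebras is a Poisson algebra. -/
noncomputable instance tensorProduct : PoissonAlgebra K (A ⊗[K] B) where
  bracket := tensorBracket K A B
  bracket_self := tensorBracket_self K
  jacobi := tensorBracket_jacobi K
  leibniz := tensorBracket_leibniz K

end Tensor

/-- The base ring with the zero bracket, which is its only `K`-bilinear Lie bracket. -/
noncomputable instance base (K : Type u) [CommRing K] : PoissonAlgebra K K where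
  bracket := 0
  bracket_self := by simp
  jacobi := by simp
  leibniz := by simp

end PoissonAlgebra

section RestrictedLie

variable {K : Type u} {L : Type v} [Field K] [AddCommGroup L] [Module K L]

/-- `s_i(x, y)`: the coefficient of `t ^ (i - 1)` in `(ad_{t x + y}) ^ (p - 1) (x)`, where
`ad_{t x + y} = t ad_x + ad_y` is a polynomial in `t` with coefficients in `End_K(L)`. -/
noncomputable def jacobsonS (p : ℕ) (br : L →ₗ[K] L →ₗ[K] L) (i : ℕ) (x y : L) : L :=
  (((Polynomial.X * Polynomial.C (br x : Module.End K L) + Polynomial.C (br y) :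
    (Module.End K L)[X]) ^ (p - 1)).coeff (i - 1)) x

/-- `Λ_p(x, y) = ∑_{i = 1}^{p - 1} s_i(x, y) / i`. -/
noncomputable def jacobsonLambda (p : ℕ) (br : L →ₗ[K] L →ₗ[K] L) (x y : L) : L :=
  ∑ i ∈ Finset.Icc 1 (p - 1), (i : K)⁻¹ • jacobsonS p br i x y

/-- `γ` is a `p`-map making `L`, with the Lie bracket `br`, a restricted Lie algebra. -/
structure IsRestrictedLiePMap (p : ℕ) (br : L →ₗ[K] L →ₗ[K] L) (γ : L → L) : Prop where
  ad_pow : ∀ x, (br x : Module.End K L) ^ p = br (γ x)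
  map_smul : ∀ (c : K) (x : L), γ (c • x) = c ^ p • γ x
  map_add : ∀ x y, γ (x + y) = γ x + γ y + jacobsonLambda p br x y

end RestrictedLie

section RestrictedPoisson

variable (K : Type u) [Field K] (p : ℕ)

/-- `γ` is a restricted Poisson structure on the Poisson algebra `A`. -/
structure IsRestrictedPoissonStructure {A : Type v} [CommRing A] [Algebra K A]
    [PoissonAlgebra K A] (γ : A → A) : Prop where
  isRestrictedLie : IsRestrictedLiePMap p (PoissonAlgebra.bracket (K := K) (A := A)) γ
  map_sq : ∀ x, γ (x ^ 2) = 2 * x ^ p * γ x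

/-- The algebra homomorphism `f` is a morphism of restricted Poisson algebras for the `p`-maps
`γ` on `A` and `δ` on `B`. -/
structure IsRestrictedPoissonHom {A : Type v} {B : Type w} [CommRing A] [Algebra K A]
    [PoissonAlgebra K A] [CommRing B] [Algebra K B] [PoissonAlgebra K B]
    (γ : A → A) (δ : B → B) (f : A →ₐ[K] B) : Prop where
  map_bracket : ∀ x y,
    f (PoissonAlgebra.bracket (K := K) x y) = PoissonAlgebra.bracket (K := K) (f x) (f y)
  map_pmap : ∀ x, f (γ x) = δ (f x)

/-- `γ` is a restricted Poisson structure on the Poisson algebra `A ⊗ B` given on pure tensors by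
`γ (a ⊗ b) = α a ⊗ b ^ p + a ^ p ⊗ β b`. -/
structure IsTensorPMap {A : Type v} {B : Type w} [CommRing A] [Algebra K A]
    [PoissonAlgebra K A] [CommRing B] [Algebra K B] [PoissonAlgebra K B]
    (α : A → A) (β : B → B) (γ : A ⊗[K] B → A ⊗[K] B) : Prop where
  isRestricted : IsRestrictedPoissonStructure K p γ
  map_tmul : ∀ (a : A) (b : B), γ (a ⊗ₜ[K] b) = α a ⊗ₜ[K] (b ^ p) + (a ^ p) ⊗ₜ[K] β b

end RestrictedPoisson

/-- A bundled restricted Poisson algebra over `K`. -/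
structure RestrictedPoissonCat (K : Type u) [Field K] (p : ℕ) where
  carrier : Type u
  [commRing : CommRing carrier]
  [algebra : Algebra K carrier]
  [poisson : PoissonAlgebra K carrier]
  /-- The `p`-map. -/
  pmap : carrier → carrier
  isRestricted : IsRestrictedPoissonStructure K p pmap

namespace RestrictedPoissonCat

attribute [instance] commRing algebra poisson

variable {K : Type u} [Field K] {p : ℕ}

/-- Morphisms of restricted Poisson algebras. -/
@[ext]
structure Hom (X Y : RestrictedPoissonCat K p) where
  toAlgHom : X.carrier →ₐ[K] Y.carrier
  isHom : IsRestrictedPoissonHom K X.pmap Y.pmap toAlgHom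

/-- The category of restricted Poisson algebras over `K`. -/
instance : Category (RestrictedPoissonCat K p) where
  Hom X Y := Hom X Y
  id X := ⟨AlgHom.id K X.carrier, ⟨fun _ _ => rfl, fun _ => rfl⟩⟩
  comp f g := ⟨g.toAlgHom.comp f.toAlgHom,
    ⟨fun x y => by simp [f.isHom.map_bracket, g.isHom.map_bracket],
      fun x => by simp [f.isHom.map_pmap, g.isHom.map_pmap]⟩⟩

variable (K p) in
/-- The functor forgetting the bracket and the `p`-map. -/
def forgetPoisson : RestrictedPoissonCat K p ⥤ CommAlgCat.{u} K where
  obj X := CommAlgCat.of K X.carrier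
  map f := CommAlgCat.ofHom f.toAlgHom

/-- For a monoidal category structure on restricted Poisson algebras along which the forgetful
functor is lax monoidal, the structure map `X ⊗ Y → X ⊗ Y` from the tensor product of the
underlying algebras to the underlying algebra of the tensor product. -/
def comparison [MonoidalCategory (RestrictedPoissonCat K p)] [(forgetPoisson K p).LaxMonoidal]
    (X Y : RestrictedPoissonCat K p) :
    X.carrier ⊗[K] Y.carrier →ₐ[K] (X ⊗ Y).carrier :=
  (Functor.LaxMonoidal.μ (forgetPoisson K p) X Y).hom

end RestrictedPoissonCat

section Hopf

variable (K : Type u) [Field K] (p : ℕ) {H : Type v} [CommRing H]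

/-- `S` is an anti-automorphism of the restricted Poisson algebra `H` with `p`-map `γ`. -/
structure IsRestrictedPoissonAntiAut [Algebra K H] [PoissonAlgebra K H]
    (γ : H → H) (S : H →ₗ[K] H) : Prop where
  bijective : Function.Bijective S
  map_one : S 1 = 1
  map_mul : ∀ x y, S (x * y) = S y * S x
  map_bracket : ∀ x y,
    S (PoissonAlgebra.bracket (K := K) x y) = PoissonAlgebra.bracket (K := K) (S y) (S x)
  map_pmap : ∀ x, S (γ x) = γ (S x)

/-- `H`, a Hopf algebra and a Poisson algebra, is a restricted Poisson Hopf algebra with `p`-map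
`γ`. The comultiplication is a morphism for the tensor product structure on `H ⊗ H`, and the
`p`-map of `K` is zero. -/
structure IsRestrictedPoissonHopf [HopfAlgebra K H] [PoissonAlgebra K H] (γ : H → H) : Prop where
  isRestricted : IsRestrictedPoissonStructure K p γ
  comul : ∃ δ : H ⊗[K] H → H ⊗[K] H, IsTensorPMap K p γ γ δ ∧
    IsRestrictedPoissonHom K γ δ (Bialgebra.comulAlgHom K H)
  counit : IsRestrictedPoissonHom K γ (fun _ : K => (0 : K)) (Bialgebra.counitAlgHom K H)
  antipode : IsRestrictedPoissonAntiAut K γ (HopfAlgebra.antipode K (A := H))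

end Hopf

/-! Uniqueness is easy: Jacobson's term Λ governs `p`-maps on sums, so a `p`-map on `A ⊗ B` is
determined by pure tensors. Existence has a Lie half and a product half, both resting on universal
identities for Λ.

Lie half. Λ is a symmetric 2-cocycle, homogeneous of weight `p` in scalars. Hence the pairs (x,
value) form a `K`-module `PMapExtension`, an extension of `L` by its Frobenius twist, and a map
satisfying the sum and scalar laws of a `p`-map is the same as a linear section. The prescribed
formula on (a, b) is bilinear into this extension because `a ⊗ 1` and `1 ⊗ b` commute, so the
universal property of the tensor product supplies the section. The law for `ad ^ p` holds on pure
tensors (a sum of two commuting operators) and passes to sums by Jacobson's formula.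

Product half. Polarizing the rule for squares turns it into 2(xy)^{p} = 2x^p y^{p} + 2y^p x^{p} +
Φ(x, y), where Φ is `leibnizDefect`. The failure of this rule is symmetric and biadditive, and it is
a Hochschild cocycle because Φ is one. On `A ⊗ B` it vanishes inside each factor and between the
factors, hence everywhere (`productDefect_tensor_eq_zero`).

Universal identities. For a derivation D put ω(x) = ad_x^(p-1)(Dx), the would-be differential of
x^{p}. Then D Λ(x, y) = ω(x+y) - ω(x) - ω(y) (`IsDerivation.map_jacobsonLambda`), so each identity
expected of `p`-maps holds after differentiation. For generic elements x X_i over a polynomial ring,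
a degree count removes the remaining constants (`eq_zero_of_homogeneous`). The cocycle identity for
Φ escapes this count, since the monomial (X_0 X_1 X_2)^p may survive; `leibnizCoboundary_eq_zero`
proves it by trilinearity and a rescaling over Laurent polynomials.

The monoidal structure is then lifted along the faithful forgetful functor to commutative algebras.
-/

set_option linter.unusedSectionVars false

/-! ### Coefficients of (t ad_x + ad_y)^k and Jacobson's Λ. -/

section AdCoeff

variable {K : Type u} {L : Type v} [Field K] [AddCommGroup L] [Module K L]

/-- The coefficient of `t ^ i` in `(ad_{t x + y}) ^ k (w)`. -/
noncomputable def adCoeff (br : L →ₗ[K] L →ₗ[K] L) (k i : ℕ) (x y w : L) : L :=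
  (((Polynomial.X * Polynomial.C (br x : Module.End K L) + Polynomial.C (br y) :
    (Module.End K L)[X]) ^ k).coeff i) w

variable (br : L →ₗ[K] L →ₗ[K] L)

theorem jacobsonS_eq_adCoeff (p i : ℕ) (x y : L) :
    jacobsonS p br i x y = adCoeff br (p - 1) (i - 1) x y x := rfl

theorem adCoeff_zero_left (i : ℕ) (x y w : L) :
    adCoeff br 0 i x y w = if i = 0 then w else 0 := by
  unfold adCoeff
  rw [pow_zero, Polynomial.coeff_one]
  split_ifs <;> simp

theorem adCoeff_succ_zero (k : ℕ) (x y w : L) :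
    adCoeff br (k + 1) 0 x y w = br y (adCoeff br k 0 x y w) := by
  simp [adCoeff, pow_succ', add_mul, mul_assoc]

theorem adCoeff_succ_succ (k i : ℕ) (x y w : L) :
    adCoeff br (k + 1) (i + 1) x y w =
      br x (adCoeff br k i x y w) + br y (adCoeff br k (i + 1) x y w) := by
  simp [adCoeff, pow_succ', add_mul, mul_assoc, Polynomial.coeff_X_mul]

theorem adCoeff_zero_right (k : ℕ) (x y w : L) :
    adCoeff br k 0 x y w = ((br y : Module.End K L) ^ k) w := by
  induction k with
  | zero => simp [adCoeff_zero_left]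
  | succ k ih => rw [adCoeff_succ_zero, ih, pow_succ']; rfl

theorem adCoeff_eq_zero_of_lt {k i : ℕ} (h : k < i) (x y w : L) :
    adCoeff br k i x y w = 0 := by
  induction k generalizing i with
  | zero => rw [adCoeff_zero_left, if_neg h.ne']
  | succ k ih =>
    obtain ⟨j, rfl⟩ : ∃ j, i = j + 1 := ⟨i - 1, by omega⟩
    rw [adCoeff_succ_succ, ih (by omega), ih (by omega)]
    simp

theorem adCoeff_self (k : ℕ) (x y w : L) :
    adCoeff br k k x y w = ((br x : Module.End K L) ^ k) w := by
  induction k with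
  | zero => simp [adCoeff_zero_left]
  | succ k ih =>
    rw [adCoeff_succ_succ, ih, adCoeff_eq_zero_of_lt br (Nat.lt_succ_self k), pow_succ']
    simp

/-- The sum of the coefficients is the value at t = 1. -/
theorem sum_adCoeff (k : ℕ) (x y w : L) :
    ∑ i ∈ Finset.range (k + 1), adCoeff br k i x y w =
      ((br (x + y) : Module.End K L) ^ k) w := by
  induction k with
  | zero => simp [adCoeff_zero_left]
  | succ k ih =>
    rw [Finset.sum_range_succ', pow_succ', Module.End.mul_apply, ← ih]
    simp only [adCoeff_succ_succ, adCoeff_succ_zero, Finset.sum_add_distrib, ← map_sum]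
    rw [map_add, LinearMap.add_apply, add_assoc, ← map_add,
      ← Finset.sum_range_succ' (fun i => adCoeff br k i x y w),
      Finset.sum_range_succ _ (k + 1), adCoeff_eq_zero_of_lt br (Nat.lt_succ_self k), add_zero]

theorem adCoeff_eq_zero_of_bracket_eq_zero {x y w : L} (hx : br x w = 0) (hy : br y w = 0)
    {k : ℕ} (hk : k ≠ 0) (i : ℕ) : adCoeff br k i x y w = 0 := by
  obtain ⟨k, rfl⟩ := Nat.exists_eq_succ_of_ne_zero hk
  clear hk
  induction k generalizing i with
  | zero =>
    cases i with
    | zero => simp [adCoeff_succ_zero, adCoeff_zero_left, hy]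
    | succ i =>
      rw [adCoeff_succ_succ, adCoeff_zero_left, adCoeff_zero_left]
      split_ifs <;> simp [hx, hy]
  | succ k ih =>
    cases i with
    | zero => rw [adCoeff_succ_zero, ih, map_zero]
    | succ i => rw [adCoeff_succ_succ, ih, ih, map_zero, map_zero, add_zero]

theorem map_adCoeff {M : Type w} [AddCommGroup M] [Module K M] (br' : M →ₗ[K] M →ₗ[K] M)
    (f : L →ₗ[K] M) (hf : ∀ x y, f (br x y) = br' (f x) (f y)) (k i : ℕ) (x y w : L) :
    f (adCoeff br k i x y w) = adCoeff br' k i (f x) (f y) (f w) := by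
  induction k generalizing i with
  | zero => rw [adCoeff_zero_left, adCoeff_zero_left]; split_ifs <;> simp
  | succ k ih =>
    cases i with
    | zero => rw [adCoeff_succ_zero, adCoeff_succ_zero, hf, ih]
    | succ i => rw [adCoeff_succ_succ, adCoeff_succ_succ, map_add, hf, hf, ih, ih]

/-- Serves both gradings, with `V` the homogeneous parts of a polynomial extension, and closed
subspaces, with `V` constant. -/
theorem adCoeff_mem (V : ℕ → Submodule K L)
    (hV : ∀ i j x y, x ∈ V i → y ∈ V j → br x y ∈ V (i + j)) {n m : ℕ} {x y w : L}
    (hx : x ∈ V n) (hy : y ∈ V n) (hw : w ∈ V m) (k i : ℕ) :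
    adCoeff br k i x y w ∈ V (k * n + m) := by
  induction k generalizing i with
  | zero =>
    rw [adCoeff_zero_left, zero_mul, zero_add]
    split_ifs
    exacts [hw, zero_mem _]
  | succ k ih =>
    rw [show (k + 1) * n + m = n + (k * n + m) by ring]
    cases i with
    | zero => rw [adCoeff_succ_zero]; exact hV _ _ _ _ hy (ih _)
    | succ i =>
      rw [adCoeff_succ_succ]
      exact add_mem (hV _ _ _ _ hx (ih _)) (hV _ _ _ _ hy (ih _))

theorem map_jacobsonLambda {M : Type w} [AddCommGroup M] [Module K M]
    (br' : M →ₗ[K] M →ₗ[K] M) (f : L →ₗ[K] M) (hf : ∀ x y, f (br x y) = br' (f x) (f y))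
    (p : ℕ) (x y : L) :
    f (jacobsonLambda p br x y) = jacobsonLambda p br' (f x) (f y) := by
  simp only [jacobsonLambda, jacobsonS_eq_adCoeff, map_sum, map_smul,
    map_adCoeff br br' f hf]

theorem jacobsonLambda_mem (V : ℕ → Submodule K L)
    (hV : ∀ i j x y, x ∈ V i → y ∈ V j → br x y ∈ V (i + j)) {p n : ℕ} (hp : 0 < p) {x y : L}
    (hx : x ∈ V n) (hy : y ∈ V n) : jacobsonLambda p br x y ∈ V (p * n) := by
  refine Submodule.sum_mem _ fun i _ => Submodule.smul_mem _ _ ?_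
  have := adCoeff_mem br V hV hx hy hx (p - 1) (i - 1)
  rwa [show (p - 1) * n + n = p * n by
    obtain ⟨q, rfl⟩ := Nat.exists_eq_succ_of_ne_zero hp.ne'
    simp; ring] at this

theorem jacobsonLambda_mem_of_closed (V : Submodule K L) (hV : ∀ x ∈ V, ∀ y ∈ V, br x y ∈ V)
    {p : ℕ} (hp : 0 < p) {x y : L} (hx : x ∈ V) (hy : y ∈ V) : jacobsonLambda p br x y ∈ V :=
  jacobsonLambda_mem br (fun _ => V) (fun _ _ x y hx hy => hV x hx y hy) (n := 0) hp hx hy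

theorem jacobsonLambda_eq_zero {p : ℕ} (hp : 2 ≤ p) {x y : L} (hx : br x x = 0)
    (hy : br y x = 0) : jacobsonLambda p br x y = 0 := by
  refine Finset.sum_eq_zero fun i _ => ?_
  rw [jacobsonS_eq_adCoeff, adCoeff_eq_zero_of_bracket_eq_zero br hx hy (by omega), smul_zero]

end AdCoeff

namespace PoissonAlgebra

/-! ### Poisson calculus, and factoring central elements out of Λ. -/

section Basic

variable {K : Type u} [Field K] {L : Type v} [CommRing L] [Algebra K L] [PoissonAlgebra K L]

local notation "ad" => PoissonAlgebra.bracket (K := K)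

theorem bracket_one_left (x : L) : ad 1 x = 0 := by
  have h := leibniz (K := K) (1 : L) 1 x
  simp only [mul_one, one_mul] at h
  exact left_eq_add.mp h

theorem bracket_one_right (x : L) : ad x 1 = 0 := by
  rw [bracket_skew, bracket_one_left, neg_zero]

theorem bracket_eq_zero_symm {x y : L} (h : ad x y = 0) : ad y x = 0 := by
  rw [bracket_skew, h, neg_zero]

theorem bracket_pow_left (x y : L) (n : ℕ) : ad (x ^ n) y = n * x ^ (n - 1) * ad x y := by
  induction n with
  | zero => simp [bracket_one_left]
  | succ n ih =>
    rw [pow_succ, leibniz, ih]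
    cases n with
    | zero => simp
    | succ n => simp; ring

theorem bracket_pow_right (x y : L) (n : ℕ) : ad x (y ^ n) = n * y ^ (n - 1) * ad x y := by
  rw [bracket_skew, bracket_pow_left, bracket_skew K y x]; ring

theorem bracket_jacobi_left (x y z : L) : ad (ad x y) z = ad x (ad y z) - ad y (ad x z) := by
  have h := jacobi (K := K) x y z
  rw [bracket_skew K z (ad x y), bracket_skew K z x, map_neg] at h
  linear_combination -h

theorem bracket_leibniz_bracket (x y z : L) : ad x (ad y z) = ad (ad x y) z + ad y (ad x z) := by
  rw [bracket_jacobi_left]; ring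

/-- An iterated bracket with k brackets has k + 1 entries, and each contributes one factor c. The
first conjunct keeps the induction going, since c must also commute with the inner brackets. -/
theorem adCoeff_mul {c x y w : L} (hx : ad c x = 0) (hy : ad c y = 0) (hw : ad c w = 0)
    (k i : ℕ) : ad c (adCoeff ad k i x y w) = 0 ∧
      adCoeff ad k i (c * x) (c * y) (c * w) = c ^ (k + 1) * adCoeff ad k i x y w := by
  have key : ∀ u v : L, ad c u = 0 → ad c v = 0 → ad c (ad u v) = 0 ∧
      ∀ n, ad (c * u) (c ^ n * v) = c ^ (n + 1) * ad u v := by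
    intro u v hu hv
    refine ⟨by rw [bracket_leibniz_bracket, hu, hv]; simp, fun n => ?_⟩
    rw [leibniz, leibniz_right, leibniz_right, hv, bracket_pow_right, bracket_pow_right,
      bracket_self, bracket_eq_zero_symm hu]
    ring
  induction k generalizing i with
  | zero =>
    simp only [adCoeff_zero_left]
    split_ifs <;> simp [hw]
  | succ k ih =>
    cases i with
    | zero =>
      simp only [adCoeff_succ_zero]
      rw [(ih 0).2]
      exact ⟨(key _ _ hy (ih 0).1).1, (key _ _ hy (ih 0).1).2 _⟩
    | succ i =>
      simp only [adCoeff_succ_succ]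
      rw [(ih i).2, (ih (i + 1)).2, map_add, (key _ _ hy (ih (i + 1)).1).1,
        (key _ _ hx (ih i).1).1, (key _ _ hy (ih (i + 1)).1).2, (key _ _ hx (ih i).1).2]
      exact ⟨by simp, by ring⟩

theorem jacobsonLambda_mul {c x y : L} {p : ℕ} (hp : 0 < p) (hx : ad c x = 0) (hy : ad c y = 0) :
    jacobsonLambda p ad (c * x) (c * y) = c ^ p * jacobsonLambda p ad x y := by
  simp only [jacobsonLambda, jacobsonS_eq_adCoeff, (adCoeff_mul hx hy hx _ _).2,
    Nat.sub_add_cancel hp, Finset.mul_sum, mul_smul_comm]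

/-- The Poisson structure with bracket multiplied by a Casimir element. -/
@[reducible]
noncomputable def scale (c : L) (hc : ∀ x, ad c x = 0) : PoissonAlgebra K L where
  bracket := (bracket (K := K) (A := L)).compr₂ (LinearMap.mulLeft K c)
  bracket_self x := by simp [bracket_self]
  jacobi x y z := by
    have h := jacobi (K := K) x y z
    simp only [LinearMap.compr₂_apply, LinearMap.mulLeft_apply, leibniz_right,
      bracket_eq_zero_symm (hc _)]
    linear_combination c * c * h
  leibniz x y z := by
    simp only [LinearMap.compr₂_apply, LinearMap.mulLeft_apply, leibniz]
    ring

theorem scale_bracket (c : L) (hc : ∀ x, ad c x = 0) (x y : L) :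
    (scale c hc).bracket x y = c * ad x y := rfl

/-- Here each of the k brackets, rather than each entry, contributes a factor c. -/
theorem adCoeff_scale (c : L) (hc : ∀ x, ad c x = 0) (k i : ℕ) (x y w : L) :
    adCoeff (scale c hc).bracket k i x y w = c ^ k * adCoeff ad k i x y w := by
  have key : ∀ n (u v : L), ad u (c ^ n * v) = c ^ n * ad u v := by
    intro n u v
    rw [leibniz_right, bracket_pow_right, bracket_eq_zero_symm (hc u)]
    ring
  induction k generalizing i with
  | zero => simp only [adCoeff_zero_left]; simp
  | succ k ih =>
    cases i with
    | zero => rw [adCoeff_succ_zero, adCoeff_succ_zero, ih, scale_bracket, key]; ring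
    | succ i =>
      rw [adCoeff_succ_succ, adCoeff_succ_succ, ih, ih, scale_bracket, scale_bracket, key, key]
      ring

theorem jacobsonLambda_scale (c : L) (hc : ∀ x, ad c x = 0) (p : ℕ) (x y : L) :
    jacobsonLambda p (scale c hc).bracket x y = c ^ (p - 1) * jacobsonLambda p ad x y := by
  simp only [jacobsonLambda, jacobsonS_eq_adCoeff, adCoeff_scale, Finset.mul_sum, mul_smul_comm]

end Basic

end PoissonAlgebra

/-! ### Binomials modulo p, derivations, and closedness of ad_z^(p-1). -/

section CharP

variable {K : Type u} [Field K] (p : ℕ) [hpr : Fact p.Prime] [CharP K p]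

-- Neighbouring entries of row p - 1 of Pascal's triangle add up to an inner entry of row p, which
-- is 0 modulo p; so the signs alternate.
include K in
theorem choose_pred_prime_cast {j : ℕ} (hj : j < p) :
    ((p - 1).choose j : K) = (-1) ^ j := by
  induction j with
  | zero => simp
  | succ j ih =>
    have h1 : (((p - 1).choose j + (p - 1).choose (j + 1) : ℕ) : K) = 0 := by
      rw [← Nat.choose_succ_succ', Nat.sub_add_cancel hpr.out.one_lt.le,
        CharP.cast_eq_zero_iff K p]
      exact hpr.out.dvd_choose_self (by omega) hj
    push_cast at h1
    rw [ih (by omega)] at h1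
    rw [pow_succ]
    linear_combination h1

end CharP

namespace PoissonAlgebra

section Derivation

variable (K : Type u) [Field K] {L : Type v} [CommRing L] [Algebra K L] [PoissonAlgebra K L]

/-- A derivation of the product and of the bracket. -/
structure IsDerivation (D : L →ₗ[K] L) : Prop where
  map_mul : ∀ x y, D (x * y) = x * D y + y * D x
  map_bracket : ∀ x y,
    D (bracket (K := K) x y) = bracket (K := K) (D x) y + bracket (K := K) x (D y)

variable {K}

local notation "ad" => PoissonAlgebra.bracket (K := K)

theorem isDerivation_bracket (w : L) : IsDerivation K (ad w) where
  map_mul := leibniz_right K w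
  map_bracket x y := bracket_leibniz_bracket w x y

namespace IsDerivation

variable {D E : L →ₗ[K] L} (hD : IsDerivation K D) (hE : IsDerivation K E)
include hD

/-- Moving D past one factor ad_z leaves ad_{Dz} there; distributing the remaining outer ad_z by the
Leibniz rule collects the binomial coefficients by Pascal's rule. -/
theorem map_bracket_pow (z w : L) (m : ℕ) :
    D (((ad z : Module.End K L) ^ (m + 1)) w) = ((ad z : Module.End K L) ^ (m + 1)) (D w) +
      ∑ ij ∈ Finset.HasAntidiagonal.antidiagonal m, ((m + 1).choose (ij.1 + 1) : K) •
        ad (((ad z : Module.End K L) ^ ij.1) (D z)) (((ad z : Module.End K L) ^ ij.2) w) := by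
  induction m with
  | zero => simp [hD.map_bracket, add_comm]
  | succ m ih =>
    rw [pow_succ', Module.End.mul_apply, hD.map_bracket, ih, map_add, map_sum]
    have h1 : ∀ ij : ℕ × ℕ, ad z (((m + 1).choose (ij.1 + 1) : K) •
        ad (((ad z : Module.End K L) ^ ij.1) (D z)) (((ad z : Module.End K L) ^ ij.2) w)) =
        ((m + 1).choose (ij.1 + 1) : K) • ad (((ad z : Module.End K L) ^ (ij.1 + 1)) (D z))
          (((ad z : Module.End K L) ^ ij.2) w) +
        ((m + 1).choose (ij.1 + 1) : K) • ad (((ad z : Module.End K L) ^ ij.1) (D z))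
          (((ad z : Module.End K L) ^ (ij.2 + 1)) w) := by
      intro ij
      rw [map_smul, bracket_leibniz_bracket, smul_add, pow_succ', pow_succ']
      rfl
    simp only [h1, Finset.sum_add_distrib]
    have h2 : ∀ ij : ℕ × ℕ, ((m + 1 + 1).choose (ij.1 + 1) : K) =
        ((m + 1).choose ij.1 : K) + ((m + 1).choose (ij.1 + 1) : K) := by
      intro ij
      rw [Nat.choose_succ_succ']; push_cast; rfl
    simp only [h2, add_smul, Finset.sum_add_distrib]
    rw [Finset.Nat.sum_antidiagonal_succ (n := m), Finset.Nat.sum_antidiagonal_succ' (n := m)]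
    simp only [Nat.choose_zero_right, Nat.cast_one, one_smul, pow_zero, Module.End.one_apply]
    rw [Nat.choose_eq_zero_of_lt (Nat.lt_succ_self (m + 1)), Nat.cast_zero, zero_smul,
      Module.End.mul_apply]
    abel

variable {p : ℕ} [hpr : Fact p.Prime] [CharP K p] (hp : 3 ≤ p)
include hE hp

/-- The form `w ↦ ad_z ^ (p - 1) (w)` at `z` is closed. -/
theorem closed_bracket_pow (z : L) (h : D (E z) = E (D z)) :
    D (((ad z : Module.End K L) ^ (p - 1)) (E z)) =
      E (((ad z : Module.End K L) ^ (p - 1)) (D z)) := by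
  obtain ⟨q, rfl⟩ : ∃ q, p = q + 2 := ⟨p - 2, by omega⟩
  have hodd : Odd (q + 2) := hpr.out.odd_of_ne_two (by omega)
  have hch : ∀ ij ∈ Finset.HasAntidiagonal.antidiagonal q, ((q + 1).choose (ij.1 + 1) : K) = (-1) ^ (ij.1 + 1) := by
    intro ij hij
    rw [Finset.HasAntidiagonal.mem_antidiagonal] at hij
    exact choose_pred_prime_cast (K := K) (q + 2) (by omega)
  rw [show q + 2 - 1 = q + 1 from rfl, hD.map_bracket_pow, hE.map_bracket_pow, h]
  congr 1
  -- After exchanging the two indices the sums agree term by term: the bracket changes sign, and so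
  -- does the binomial, because the indices add up to the odd number p - 2.
  rw [← Finset.Nat.sum_antidiagonal_swap]
  refine Finset.sum_congr rfl fun ij hij => ?_
  rw [hch _ (Finset.HasAntidiagonal.swap_mem_antidiagonal.mpr hij), hch _ hij, bracket_skew, smul_neg, ← neg_smul]
  rw [Finset.HasAntidiagonal.mem_antidiagonal] at hij
  simp only [Prod.fst_swap, Prod.snd_swap]
  congr 1
  have : Odd (ij.1 + ij.2) := by
    rw [hij]; rw [Nat.odd_add] at hodd; simpa using hodd
  rcases Nat.even_or_odd ij.1 with h1 | h1
  · have h2 : Odd ij.2 := by rw [Nat.odd_add'] at this; exact this.mpr h1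
    rw [pow_succ, pow_succ, h1.neg_one_pow, h2.neg_one_pow]; ring
  · have h2 : Even ij.2 := by rw [Nat.odd_add] at this; exact this.mp h1
    rw [pow_succ, pow_succ, h1.neg_one_pow, h2.neg_one_pow]; ring

end IsDerivation

end Derivation

/-! ### Extension of L by coefficient algebras with zero bracket. -/

section TrivialBracket

variable (K : Type u) [Field K]

/-- The zero bracket. -/
@[reducible]
noncomputable def zeroBracket (C : Type v) [CommRing C] [Algebra K C] : PoissonAlgebra K C where
  bracket := 0
  bracket_self := by simp
  jacobi := by simp
  leibniz := by simp

noncomputable instance : PoissonAlgebra K K[X] := zeroBracket K _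
noncomputable instance (σ : Type v) : PoissonAlgebra K (MvPolynomial σ K) := zeroBracket K _
noncomputable instance : PoissonAlgebra K (LaurentPolynomial K) := zeroBracket K _

/-- Poisson algebras with zero bracket. -/
class HasZeroBracket (C : Type v) [CommRing C] [Algebra K C] [PoissonAlgebra K C] : Prop where
  bracket_eq_zero : ∀ c d : C, bracket (K := K) c d = 0

instance : HasZeroBracket K K[X] := ⟨fun _ _ => rfl⟩
instance (σ : Type v) : HasZeroBracket K (MvPolynomial σ K) := ⟨fun _ _ => rfl⟩
instance : HasZeroBracket K (LaurentPolynomial K) := ⟨fun _ _ => rfl⟩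

end TrivialBracket

section BaseChange

variable {K : Type u} [Field K] {L : Type v} [CommRing L] [Algebra K L] [PoissonAlgebra K L]
  {C : Type w} [CommRing C] [Algebra K C] [PoissonAlgebra K C]

local notation "ad" => PoissonAlgebra.bracket (K := K)

theorem bracket_tmul (a a' : L) (b b' : C) :
    ad (a ⊗ₜ[K] b) (a' ⊗ₜ[K] b') = ad a a' ⊗ₜ (b * b') + (a * a') ⊗ₜ ad b b' :=
  tensorBracket_tmul K a a' b b'

theorem bracket_tmul_of_hasZeroBracket [HasZeroBracket K C] (a a' : L) (b b' : C) :
    ad (a ⊗ₜ[K] b) (a' ⊗ₜ[K] b') = ad a a' ⊗ₜ (b * b') := by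
  rw [bracket_tmul, HasZeroBracket.bracket_eq_zero b b', TensorProduct.tmul_zero, add_zero]

/-- Bilinear identities for brackets on tensor products can be checked on pure tensors. -/
theorem map_bracket_of_tmul {M : Type*} [CommRing M] [Algebra K M] [PoissonAlgebra K M]
    (f : L ⊗[K] C →ₗ[K] M)
    (h : ∀ a b a' b', f (ad (a ⊗ₜ[K] b) (a' ⊗ₜ[K] b')) = ad (f (a ⊗ₜ b)) (f (a' ⊗ₜ b')))
    (x y : L ⊗[K] C) : f (ad x y) = ad (f x) (f y) := by
  induction x with
  | zero => simp
  | add x x' hx hx' => simp only [map_add, LinearMap.add_apply, hx, hx']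
  | tmul a b =>
    induction y with
    | zero => simp
    | add y y' hy hy' => simp only [map_add, hy, hy']
    | tmul a' b' => exact h a b a' b'

theorem tensorMap_bracket {L' : Type*} {C' : Type*} [CommRing L'] [Algebra K L']
    [PoissonAlgebra K L'] [CommRing C'] [Algebra K C'] [PoissonAlgebra K C']
    (f : L →ₐ[K] L') (g : C →ₐ[K] C') (hf : ∀ x y, f (ad x y) = ad (f x) (f y))
    (hg : ∀ x y, g (ad x y) = ad (g x) (g y)) (x y : L ⊗[K] C) :
    Algebra.TensorProduct.map f g (ad x y) =
      ad (Algebra.TensorProduct.map f g x) (Algebra.TensorProduct.map f g y) := by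
  refine map_bracket_of_tmul (Algebra.TensorProduct.map f g).toLinearMap ?_ x y
  intro a b a' b'
  simp [bracket_tmul, hf, hg]

/-- With zero bracket on C, only the product of C enters the bracket of `L ⊗ C`, so compatibility of
d with products is enough. -/
theorem lTensor_isDerivation [HasZeroBracket K C] (d : Derivation K C C) :
    IsDerivation K (LinearMap.lTensor L (d : C →ₗ[K] C)) where
  map_mul x y := by
    induction x with
    | zero => simp
    | add x x' hx hx' => simp only [add_mul, map_add, hx, hx', mul_add]; ring
    | tmul a b =>
      induction y with
      | zero => simp
      | add y y' hy hy' => simp only [add_mul, map_add, hy, hy', mul_add]; ring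
      | tmul a' b' =>
        simp [TensorProduct.tmul_add, mul_comm a' a]
  map_bracket x y := by
    induction x with
    | zero => simp
    | add x x' hx hx' => simp only [map_add, LinearMap.add_apply, hx, hx']; ring
    | tmul a b =>
      induction y with
      | zero => simp
      | add y y' hy hy' => simp only [map_add, hy, hy']; ring
      | tmul a' b' =>
        simp [bracket_tmul_of_hasZeroBracket, TensorProduct.tmul_add]
        rw [add_comm, mul_comm b' (d b)]

theorem rTensor_isDerivation [HasZeroBracket K C] {D : L →ₗ[K] L} (hD : IsDerivation K D) :
    IsDerivation K (LinearMap.rTensor C D) where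
  map_mul x y := by
    induction x with
    | zero => simp
    | add x x' hx hx' => simp only [add_mul, map_add, hx, hx', mul_add]; ring
    | tmul a b =>
      induction y with
      | zero => simp
      | add y y' hy hy' => simp only [add_mul, map_add, hy, hy', mul_add]; ring
      | tmul a' b' =>
        simp [TensorProduct.add_tmul, hD.map_mul, mul_comm b' b]
  map_bracket x y := by
    induction x with
    | zero => simp
    | add x x' hx hx' => simp only [map_add, LinearMap.add_apply, hx, hx']; ring
    | tmul a b =>
      induction y with
      | zero => simp
      | add y y' hy hy' => simp only [map_add, hy, hy']; ring
      | tmul a' b' =>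
        simp [bracket_tmul_of_hasZeroBracket, TensorProduct.add_tmul, hD.map_bracket]

end BaseChange

section Slice

variable {K : Type u} [Field K] (L : Type v) [AddCommGroup L] [Module K L]
  {C : Type w} [AddCommGroup C] [Module K C]

/-- The contraction of the second tensor factor with a linear functional. -/
noncomputable def slice (l : C →ₗ[K] K) : L ⊗[K] C →ₗ[K] L :=
  (TensorProduct.rid K L).toLinearMap ∘ₗ LinearMap.lTensor L l

@[simp]
theorem slice_tmul (l : C →ₗ[K] K) (x : L) (c : C) : slice L l (x ⊗ₜ c) = l c • x := by
  simp [slice]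

end Slice

/-! ### The formal differential of Λ. -/

section LambdaDerivation

variable {K : Type u} [Field K] {L : Type v} [CommRing L] [Algebra K L] [PoissonAlgebra K L]

local notation "ad" => PoissonAlgebra.bracket (K := K)

theorem slice_bracket_zero (x y : L) (ξ : L ⊗[K] K[X]) :
    slice L (Polynomial.lcoeff K 0)
      (ad (x ⊗ₜ[K] (Polynomial.X : K[X]) + y ⊗ₜ[K] (1 : K[X])) ξ) =
        ad y (slice L (Polynomial.lcoeff K 0) ξ) := by
  induction ξ with
  | zero => simp
  | add ξ ξ' h h' =>
    rw [map_add (ad _), map_add (slice L _), h, h', map_add (slice L _), map_add (ad y)]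
  | tmul a f =>
    simp [bracket_tmul_of_hasZeroBracket]

theorem slice_bracket_succ (x y : L) (i : ℕ) (ξ : L ⊗[K] K[X]) :
    slice L (Polynomial.lcoeff K (i + 1))
      (ad (x ⊗ₜ[K] (Polynomial.X : K[X]) + y ⊗ₜ[K] (1 : K[X])) ξ) =
        ad x (slice L (Polynomial.lcoeff K i) ξ) +
          ad y (slice L (Polynomial.lcoeff K (i + 1)) ξ) := by
  induction ξ with
  | zero => simp
  | add ξ ξ' h h' =>
    rw [map_add (ad _), map_add (slice L _), h, h', map_add (slice L _), map_add (slice L _),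
      map_add (ad y), map_add (ad x)]
    abel
  | tmul a f =>
    simp [bracket_tmul_of_hasZeroBracket, Polynomial.coeff_X_mul]

/-- Realizes the operator coefficients as coefficients of an element of L[t], on which d/dt acts as
a derivation. -/
theorem slice_bracket_pow_one (x y w : L) (k i : ℕ) :
    slice L (Polynomial.lcoeff K i) (((ad (x ⊗ₜ[K] (Polynomial.X : K[X]) + y ⊗ₜ[K] (1 : K[X])) :
      Module.End K (L ⊗[K] K[X])) ^ k) (w ⊗ₜ 1)) = adCoeff ad k i x y w := by
  induction k generalizing i with
  | zero => simp [adCoeff_zero_left, Polynomial.coeff_one]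
  | succ k ih =>
    rw [pow_succ', Module.End.mul_apply]
    cases i with
    | zero => rw [slice_bracket_zero, ih, adCoeff_succ_zero]
    | succ i => rw [slice_bracket_succ, ih, ih, adCoeff_succ_succ]

/-- The variable t is central, so starting from w t shifts all coefficients by one. -/
theorem slice_bracket_pow_X (x y w : L) (k i : ℕ) :
    slice L (Polynomial.lcoeff K 0) (((ad (x ⊗ₜ[K] (Polynomial.X : K[X]) + y ⊗ₜ[K] (1 : K[X])) :
      Module.End K (L ⊗[K] K[X])) ^ k) (w ⊗ₜ Polynomial.X)) = 0 ∧
    slice L (Polynomial.lcoeff K (i + 1))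
      (((ad (x ⊗ₜ[K] (Polynomial.X : K[X]) + y ⊗ₜ[K] (1 : K[X])) :
      Module.End K (L ⊗[K] K[X])) ^ k) (w ⊗ₜ Polynomial.X)) = adCoeff ad k i x y w := by
  induction k generalizing i with
  | zero => simp [adCoeff_zero_left, Polynomial.coeff_X, eq_comm]
  | succ k ih =>
    rw [pow_succ', Module.End.mul_apply]
    refine ⟨by rw [slice_bracket_zero, (ih 0).1, map_zero], ?_⟩
    rw [slice_bracket_succ, (ih i).2]
    cases i with
    | zero => rw [(ih 0).1, adCoeff_succ_zero, map_zero, zero_add]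
    | succ i => rw [(ih i).2, adCoeff_succ_succ]

variable {p : ℕ} [hpr : Fact p.Prime] [CharP K p] (hp : 3 ≤ p)
include hp

/-- Closedness of ad_z^(p-1) at z = x t + y for the commuting derivations D and d/dt, read off at
t^i. The factor i + 1 from d/dt cancels the denominator in Λ. -/
theorem IsDerivation.map_adCoeff {D : L →ₗ[K] L} (hD : IsDerivation K D) (x y : L) (i : ℕ) :
    D (adCoeff ad (p - 1) i x y x) = ((i + 1 : ℕ) : K) •
      (adCoeff ad (p - 1) i x y (D x) + adCoeff ad (p - 1) (i + 1) x y (D y)) := by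
  set z : L ⊗[K] K[X] := x ⊗ₜ[K] (Polynomial.X : K[X]) + y ⊗ₜ[K] (1 : K[X]) with hz
  have hE := lTensor_isDerivation (L := L) (Polynomial.derivative' (R := K))
  have hD' := rTensor_isDerivation (C := K[X]) hD
  have h := hD'.closed_bracket_pow hE hp z (by simp [hz])
  have hEz : LinearMap.lTensor L
      ((Polynomial.derivative' (R := K) : Derivation K K[X] K[X]) : K[X] →ₗ[K] K[X]) z = x ⊗ₜ 1 := by
    simp [hz]
  have hDz : LinearMap.rTensor K[X] D z = D x ⊗ₜ Polynomial.X + D y ⊗ₜ 1 := by simp [hz]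
  rw [hEz, hDz] at h
  have h' := congrArg (slice L (Polynomial.lcoeff K i)) h
  have c1 : ∀ ξ : L ⊗[K] K[X], slice L (Polynomial.lcoeff K i) (LinearMap.rTensor K[X] D ξ) =
      D (slice L (Polynomial.lcoeff K i) ξ) := by
    intro ξ
    induction ξ with
    | zero => simp
    | add ξ ξ' h h' => simp only [map_add, h, h']
    | tmul a f => simp
  have c2 : ∀ ξ : L ⊗[K] K[X], slice L (Polynomial.lcoeff K i) (LinearMap.lTensor L
      ((Polynomial.derivative' (R := K) : Derivation K K[X] K[X]) : K[X] →ₗ[K] K[X]) ξ) =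
      ((i + 1 : ℕ) : K) • (slice L (Polynomial.lcoeff K (i + 1)) ξ) := by
    intro ξ
    induction ξ with
    | zero => simp
    | add ξ ξ' h h' => simp only [map_add, h, h', smul_add]
    | tmul a f => simp [Polynomial.coeff_derivative, smul_smul, mul_comm]
  rw [c1, c2, slice_bracket_pow_one, map_add, map_add, (slice_bracket_pow_X _ _ _ _ _).2,
    slice_bracket_pow_one] at h'
  exact h'

/-- A derivation applied to `Λ_p (x, y)`. -/
theorem IsDerivation.map_jacobsonLambda {D : L →ₗ[K] L} (hD : IsDerivation K D) (x y : L) :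
    D (jacobsonLambda p ad x y) = ((ad (x + y) : Module.End K L) ^ (p - 1)) (D (x + y)) -
      ((ad x : Module.End K L) ^ (p - 1)) (D x) - ((ad y : Module.End K L) ^ (p - 1)) (D y) := by
  have h1 : D (jacobsonLambda p ad x y) = ∑ i ∈ Finset.range (p - 1),
      (adCoeff ad (p - 1) i x y (D x) + adCoeff ad (p - 1) (i + 1) x y (D y)) := by
    have hI : Finset.Icc 1 (p - 1) = Finset.Ico (0 + 1) (p - 1 + 1) := by ext; simp
    rw [jacobsonLambda, map_sum, hI, ← Finset.sum_Ico_add', Finset.range_eq_Ico]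
    refine Finset.sum_congr rfl fun i hi => ?_
    have hi0 : ((i + 1 : ℕ) : K) ≠ 0 := by
      rw [Ne, CharP.cast_eq_zero_iff K p]
      rw [Finset.mem_Ico] at hi
      exact fun h => absurd (Nat.le_of_dvd (Nat.succ_pos i) h) (by omega)
    rw [map_smul, jacobsonS_eq_adCoeff, Nat.add_sub_cancel, hD.map_adCoeff hp, smul_smul,
      inv_mul_cancel₀ hi0, one_smul]
  -- The two sums omit only the top coefficient for Dx and the constant one for Dy; these are
  -- ad_x^(p-1)(Dx) and ad_y^(p-1)(Dy).
  rw [h1, Finset.sum_add_distrib, map_add D, map_add ((ad (x + y) : Module.End K L) ^ (p - 1)),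
    ← sum_adCoeff, ← sum_adCoeff, Finset.sum_range_succ,
    Finset.sum_range_succ' (fun i => adCoeff ad (p - 1) i x y (D y)),
    adCoeff_self, adCoeff_zero_right]
  abel

end LambdaDerivation

end PoissonAlgebra

namespace PoissonAlgebra

/-! ### A vanishing criterion in polynomial extensions L[σ]. -/

section Homogeneous

variable {K : Type u} [Field K] {L : Type v} [CommRing L] [Algebra K L] [PoissonAlgebra K L]
  {σ : Type w}

local notation "ad" => PoissonAlgebra.bracket (K := K)

variable (K L σ) in
/-- The homogeneous elements of degree `n` of `L[σ]`. -/
noncomputable def homogeneous (n : ℕ) : Submodule K (L ⊗[K] MvPolynomial σ K) :=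
  Submodule.span K {ξ | ∃ (x : L) (f : MvPolynomial σ K), f.IsHomogeneous n ∧ x ⊗ₜ f = ξ}

theorem tmul_mem_homogeneous {n : ℕ} (x : L) {f : MvPolynomial σ K} (hf : f.IsHomogeneous n) :
    x ⊗ₜ f ∈ homogeneous K L σ n := Submodule.subset_span ⟨x, f, hf, rfl⟩

theorem homogeneous_closed
    (B : L ⊗[K] MvPolynomial σ K →ₗ[K] L ⊗[K] MvPolynomial σ K →ₗ[K] L ⊗[K] MvPolynomial σ K)
    {i j k : ℕ} (hB : ∀ x y f g, f.IsHomogeneous i → g.IsHomogeneous j →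
      B (x ⊗ₜ f) (y ⊗ₜ g) ∈ homogeneous K L σ k) {ξ η : L ⊗[K] MvPolynomial σ K}
    (hξ : ξ ∈ homogeneous K L σ i) (hη : η ∈ homogeneous K L σ j) :
    B ξ η ∈ homogeneous K L σ k := by
  induction hξ using Submodule.span_induction with
  | zero => simp
  | add a b _ _ ha hb => simpa using add_mem ha hb
  | smul c a _ ha => simpa using Submodule.smul_mem _ c ha
  | mem a ha =>
    obtain ⟨x, f, hf, rfl⟩ := ha
    induction hη using Submodule.span_induction with
    | zero => simp
    | add a b _ _ ha hb => simpa using add_mem ha hb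
    | smul c a _ ha => simpa using Submodule.smul_mem _ c ha
    | mem b hb =>
      obtain ⟨y, g, hg, rfl⟩ := hb
      exact hB x y f g hf hg

theorem bracket_mem_homogeneous (i j : ℕ) (ξ η : L ⊗[K] MvPolynomial σ K)
    (hξ : ξ ∈ homogeneous K L σ i) (hη : η ∈ homogeneous K L σ j) :
    ad ξ η ∈ homogeneous K L σ (i + j) := by
  refine homogeneous_closed (bracket (K := K)) ?_ hξ hη
  intro x y f g hf hg
  rw [bracket_tmul_of_hasZeroBracket]
  exact tmul_mem_homogeneous _ (hf.mul hg)

theorem mul_mem_homogeneous {i j : ℕ} {ξ η : L ⊗[K] MvPolynomial σ K}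
    (hξ : ξ ∈ homogeneous K L σ i) (hη : η ∈ homogeneous K L σ j) :
    ξ * η ∈ homogeneous K L σ (i + j) := by
  refine homogeneous_closed (LinearMap.mul K _) ?_ hξ hη
  intro x y f g hf hg
  rw [LinearMap.mul_apply', Algebra.TensorProduct.tmul_mul_tmul]
  exact tmul_mem_homogeneous _ (hf.mul hg)

theorem pow_mem_homogeneous {i : ℕ} {ξ : L ⊗[K] MvPolynomial σ K}
    (hξ : ξ ∈ homogeneous K L σ i) (n : ℕ) : ξ ^ n ∈ homogeneous K L σ (n * i) := by
  induction n with
  | zero =>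
    rw [pow_zero, zero_mul, Algebra.TensorProduct.one_def]
    exact tmul_mem_homogeneous _ (MvPolynomial.isHomogeneous_one _ _)
  | succ n ih => rw [pow_succ, add_mul, one_mul]; exact mul_mem_homogeneous ih hξ

theorem slice_eq_zero_of_homogeneous {n : ℕ} {ξ : L ⊗[K] MvPolynomial σ K}
    (hξ : ξ ∈ homogeneous K L σ n) {m : σ →₀ ℕ} (hm : m.degree ≠ n) :
    slice L (MvPolynomial.lcoeff K m) ξ = 0 := by
  induction hξ using Submodule.span_induction with
  | zero => simp
  | add a b _ _ ha hb => rw [map_add, ha, hb, add_zero]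
  | smul c a _ ha => rw [map_smul, ha, smul_zero]
  | mem a ha =>
    obtain ⟨x, f, hf, rfl⟩ := ha
    rw [slice_tmul, MvPolynomial.lcoeff_apply, hf.coeff_eq_zero hm, zero_smul]

theorem eq_zero_of_slice {ξ : L ⊗[K] MvPolynomial σ K}
    (h : ∀ m : σ →₀ ℕ, slice L (MvPolynomial.lcoeff K m) ξ = 0) : ξ = 0 := by
  classical
  have he : ∀ (ξ : L ⊗[K] MvPolynomial σ K) (m : σ →₀ ℕ),
      TensorProduct.equivFinsuppOfBasisRight (M := L) (MvPolynomial.basisMonomials σ K) ξ m =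
        slice L (MvPolynomial.lcoeff K m) ξ := by
    intro ξ m
    induction ξ with
    | zero => simp
    | add a b ha hb => simp only [map_add, Finsupp.add_apply, ha, hb]
    | tmul x f => simp; rfl
  apply (TensorProduct.equivFinsuppOfBasisRight (M := L)
    (MvPolynomial.basisMonomials σ K)).injective
  ext m
  rw [he, h, map_zero, Finsupp.zero_apply]

/-- Setting the variable `X i` to zero. -/
noncomputable def killVar [DecidableEq σ] (i : σ) : MvPolynomial σ K →ₐ[K] MvPolynomial σ K :=
  MvPolynomial.aeval fun j => if j = i then 0 else MvPolynomial.X j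

theorem coeff_killVar [DecidableEq σ] (i : σ) (f : MvPolynomial σ K) {m : σ →₀ ℕ} (hm : m i = 0) :
    (killVar i f).coeff m = f.coeff m := by
  induction f using MvPolynomial.induction_on' with
  | add f g hf hg => simp only [map_add, MvPolynomial.coeff_add, hf, hg]
  | monomial n a =>
    by_cases hn : n i = 0
    · congr 1
      rw [killVar, MvPolynomial.aeval_monomial, MvPolynomial.monomial_eq,
        MvPolynomial.algebraMap_eq]
      congr 1
      refine Finset.prod_congr rfl fun j hj => ?_
      have hji : j ≠ i := by
        rintro rfl
        exact (Finsupp.mem_support_iff.mp hj) hn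
      simp only [if_neg hji]
    · have h0 : killVar i (MvPolynomial.monomial n a) = 0 := by
        rw [killVar, MvPolynomial.aeval_monomial, Finsupp.prod,
          Finset.prod_eq_zero (Finsupp.mem_support_iff.mpr hn), mul_zero]
        simp [hn]
      rw [h0, MvPolynomial.coeff_zero, MvPolynomial.coeff_monomial, if_neg]
      rintro rfl
      exact hn hm

variable (L) in
/-- Extension of a homomorphism of coefficient algebras. -/
noncomputable abbrev baseMap {C : Type*} {C' : Type*} [CommRing C] [Algebra K C] [CommRing C']
    [Algebra K C'] (φ : C →ₐ[K] C') : L ⊗[K] C →ₐ[K] L ⊗[K] C' :=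
  Algebra.TensorProduct.map (AlgHom.id K L) φ

theorem baseMap_bracket {C : Type*} {C' : Type*} [CommRing C] [Algebra K C] [CommRing C']
    [Algebra K C'] [PoissonAlgebra K C] [PoissonAlgebra K C'] [HasZeroBracket K C]
    [HasZeroBracket K C'] (φ : C →ₐ[K] C') (x y : L ⊗[K] C) :
    baseMap L φ (ad x y) = ad (baseMap L φ x) (baseMap L φ y) :=
  tensorMap_bracket _ _ (fun _ _ => rfl)
    (fun x y => by simp [HasZeroBracket.bracket_eq_zero]) x y

variable (L) in
/-- Specialization along a character of the coefficient algebra. -/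
noncomputable def specialize {C : Type*} [CommRing C] [Algebra K C] (φ : C →ₐ[K] K) :
    L ⊗[K] C →ₐ[K] L :=
  Algebra.TensorProduct.lift (AlgHom.id K L) ((Algebra.ofId K L).comp φ) fun _ _ => .all _ _

theorem specialize_tmul {C : Type*} [CommRing C] [Algebra K C] (φ : C →ₐ[K] K) (x : L) (c : C) :
    specialize L φ (x ⊗ₜ c) = φ c • x := by
  simp [specialize, Algebra.ofId_apply, Algebra.smul_def, mul_comm]

theorem specialize_bracket {C : Type*} [CommRing C] [Algebra K C] [PoissonAlgebra K C]
    [HasZeroBracket K C] (φ : C →ₐ[K] K) (x y : L ⊗[K] C) :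
    specialize L φ (ad x y) = ad (specialize L φ x) (specialize L φ y) := by
  refine map_bracket_of_tmul (specialize L φ).toLinearMap ?_ x y
  intro a b a' b'
  simp [bracket_tmul_of_hasZeroBracket, specialize_tmul, smul_smul, mul_comm]

theorem slice_killVar [DecidableEq σ] (i : σ) (ξ : L ⊗[K] MvPolynomial σ K) {m : σ →₀ ℕ}
    (hm : m i = 0) : slice L (MvPolynomial.lcoeff K m) (baseMap L (killVar i) ξ) =
      slice L (MvPolynomial.lcoeff K m) ξ := by
  induction ξ with
  | zero => simp
  | add a b ha hb => simp only [map_add, ha, hb]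
  | tmul x f => simp [coeff_killVar i f hm]

variable (L) in
/-- The partial derivative on `L[σ]`. -/
noncomputable abbrev partialDeriv (i : σ) : L ⊗[K] MvPolynomial σ K →ₗ[K] L ⊗[K] MvPolynomial σ K :=
  LinearMap.lTensor L (MvPolynomial.pderiv i : Derivation K (MvPolynomial σ K) (MvPolynomial σ K))

theorem slice_partialDeriv (i : σ) (ξ : L ⊗[K] MvPolynomial σ K) (m : σ →₀ ℕ) :
    slice L (MvPolynomial.lcoeff K m) (partialDeriv L i ξ) =
      ((m i + 1 : ℕ) : K) • slice L (MvPolynomial.lcoeff K (m + Finsupp.single i 1)) ξ := by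
  induction ξ with
  | zero => simp
  | add a b ha hb => simp only [map_add, ha, hb, smul_add]
  | tmul x f =>
    simp [MvPolynomial.coeff_pderiv, smul_smul, mul_comm]

variable {p : ℕ} [hpr : Fact p.Prime] [CharP K p]

/-- The derivative multiplies the coefficient of m by m_i, which is invertible in K. -/
theorem slice_eq_zero_of_not_dvd {i : σ} {ξ : L ⊗[K] MvPolynomial σ K}
    (hξ : partialDeriv L i ξ = 0) {m : σ →₀ ℕ} (hm : ¬ p ∣ m i) :
    slice L (MvPolynomial.lcoeff K m) ξ = 0 := by
  classical
  have h := slice_partialDeriv i ξ (m - Finsupp.single i 1)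
  have hmi : m i ≠ 0 := fun h => hm (h ▸ dvd_zero p)
  have hle : Finsupp.single i 1 ≤ m := by
    rw [Finsupp.single_le_iff]; omega
  rw [hξ, map_zero, tsub_add_cancel_of_le hle] at h
  have h1 : (m - Finsupp.single i 1 : σ →₀ ℕ) i + 1 = m i := by
    simp; omega
  rw [h1] at h
  refine (smul_eq_zero.mp h.symm).resolve_left ?_
  rwa [CharP.cast_eq_zero_iff K p]

theorem slice_eq_zero_of_killVar [DecidableEq σ] {i : σ} {ξ : L ⊗[K] MvPolynomial σ K}
    (hξ : baseMap L (killVar i) ξ = 0) {m : σ →₀ ℕ} (hm : m i = 0) :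
    slice L (MvPolynomial.lcoeff K m) ξ = 0 := by
  rw [← slice_killVar i ξ hm, hξ, map_zero]

/-- A homogeneous element of small degree that has zero derivatives and no term
missing a variable vanishes. -/
theorem eq_zero_of_homogeneous [Fintype σ] [DecidableEq σ] {N : ℕ} (hN : N < Fintype.card σ * p)
    {ξ : L ⊗[K] MvPolynomial σ K} (hξ : ξ ∈ homogeneous K L σ N)
    (hD : ∀ i, partialDeriv L i ξ = 0) (h0 : ∀ i, baseMap L (killVar i) ξ = 0) : ξ = 0 := by
  refine eq_zero_of_slice fun m => ?_
  by_cases hm : m.degree = N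
  -- If all exponents were at least p, the degree would be at least p times the number of variables.
  -- An exponent below p is 0, excluded by killing the variable, or prime to p, excluded by the
  -- derivative.
  · obtain ⟨i, hi⟩ : ∃ i, m i < p := by
      by_contra! h
      have := Finset.card_nsmul_le_sum Finset.univ (fun i => m i) p (fun i _ => h i)
      rw [Finsupp.degree_eq_sum] at hm
      simp only [Finset.card_univ, smul_eq_mul] at this
      omega
    by_cases h : m i = 0
    · exact slice_eq_zero_of_killVar (h0 i) h
    · exact slice_eq_zero_of_not_dvd (hD i) fun hdvd =>
        absurd (Nat.le_of_dvd (Nat.pos_of_ne_zero h) hdvd) (by omega)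
  · exact slice_eq_zero_of_homogeneous hξ hm

end Homogeneous

/-! ### Λ is a symmetric 2-cocycle. -/

section Cocycle

variable {K : Type u} [Field K] {p : ℕ} [hpr : Fact p.Prime] [CharP K p]
  {L : Type v} [CommRing L] [Algebra K L] [PoissonAlgebra K L]

local notation "Λ" => jacobsonLambda p (PoissonAlgebra.bracket (K := K))

omit [CharP K p] in
theorem jacobsonLambda_zero_left (y : L) : Λ 0 y = 0 :=
  jacobsonLambda_eq_zero _ hpr.out.two_le (by simp) (by simp)

omit [CharP K p] in
theorem jacobsonLambda_zero_right (x : L) : Λ x 0 = 0 :=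
  jacobsonLambda_eq_zero _ hpr.out.two_le (bracket_self x) (by simp)

omit hpr [CharP K p] in
theorem map_jacobsonLambda {M : Type w} [CommRing M] [Algebra K M] [PoissonAlgebra K M]
    (f : L →ₐ[K] M) (hf : ∀ x y, f (bracket (K := K) x y) = bracket (K := K) (f x) (f y))
    (x y : L) : f (Λ x y) = Λ (f x) (f y) :=
  _root_.map_jacobsonLambda _ _ f.toLinearMap hf p x y

theorem jacobsonLambda_mem_homogeneous {σ : Type w} {n : ℕ} {ξ η : L ⊗[K] MvPolynomial σ K}
    (hξ : ξ ∈ homogeneous K L σ n) (hη : η ∈ homogeneous K L σ n) :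
    Λ ξ η ∈ homogeneous K L σ (p * n) :=
  jacobsonLambda_mem _ (homogeneous K L σ) bracket_mem_homogeneous hpr.out.pos hξ hη

/-- The element `x X_i` of `L[σ]`. -/
noncomputable abbrev tmulX {σ : Type w} (K : Type u) [Field K] {L : Type v} [CommRing L]
    [Algebra K L] (x : L) (i : σ) : L ⊗[K] MvPolynomial σ K := x ⊗ₜ MvPolynomial.X i

theorem tmulX_mem {σ : Type w} (x : L) (i : σ) : tmulX K x i ∈ homogeneous K L σ 1 :=
  tmul_mem_homogeneous _ (MvPolynomial.isHomogeneous_X _ _)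

theorem baseMap_killVar_tmulX {σ : Type w} [DecidableEq σ] (x : L) (i j : σ) :
    baseMap L (killVar (K := K) i) (tmulX K x j) = if j = i then 0 else tmulX K x j := by
  simp only [killVar, Algebra.TensorProduct.map_tmul, MvPolynomial.aeval_X]
  split_ifs <;> simp

variable (L) (K) in
/-- Setting all variables to `1`. -/
noncomputable abbrev evalOne (σ : Type w) : L ⊗[K] MvPolynomial σ K →ₐ[K] L :=
  specialize L (MvPolynomial.aeval fun _ => 1)

theorem evalOne_tmulX {σ : Type w} (x : L) (i : σ) : evalOne K L σ (tmulX K x i) = x := by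
  simp [specialize_tmul]

/-- For generic x X_0 and y X_1 both sides have the same differential and vanish when either
variable is 0; setting both variables to 1 returns to L. -/
theorem jacobsonLambda_comm (hp : 3 ≤ p) (x y : L) : Λ x y = Λ y x := by
  set X := tmulX K x (0 : Fin 2)
  set Y := tmulX K y (1 : Fin 2)
  have h : Λ X Y - Λ Y X = 0 := by
    -- Λ has degree p, less than 2p for two variables.
    refine eq_zero_of_homogeneous (p := p) (N := p * 1) (by simp; omega) (sub_mem
      (jacobsonLambda_mem_homogeneous (tmulX_mem _ _) (tmulX_mem _ _))
      (jacobsonLambda_mem_homogeneous (tmulX_mem _ _) (tmulX_mem _ _))) ?_ ?_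
    · intro i
      have hD := lTensor_isDerivation (L := L)
        (MvPolynomial.pderiv i : Derivation K (MvPolynomial (Fin 2) K) _)
      rw [map_sub, hD.map_jacobsonLambda hp, hD.map_jacobsonLambda hp, add_comm Y X]
      ring
    · intro i
      rw [map_sub, map_jacobsonLambda _ (baseMap_bracket _),
        map_jacobsonLambda _ (baseMap_bracket _), baseMap_killVar_tmulX, baseMap_killVar_tmulX]
      fin_cases i <;> simp [jacobsonLambda_zero_left, jacobsonLambda_zero_right]
  have h' := congrArg (evalOne K L (Fin 2)) h
  rw [map_sub, map_jacobsonLambda _ (specialize_bracket _),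
    map_jacobsonLambda _ (specialize_bracket _), evalOne_tmulX, evalOne_tmulX, map_zero] at h'
  exact sub_eq_zero.mp h'

/-- Both sides have differential ω(x+y+z) - ω(x) - ω(y) - ω(z). With three variables the degree p is
below the bound 3p. -/
theorem jacobsonLambda_cocycle (hp : 3 ≤ p) (x y z : L) :
    Λ x y + Λ (x + y) z = Λ y z + Λ x (y + z) := by
  set X := tmulX K x (0 : Fin 3)
  set Y := tmulX K y (1 : Fin 3)
  set Z := tmulX K z (2 : Fin 3)
  have hX : X ∈ homogeneous K L (Fin 3) 1 := tmulX_mem _ _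
  have hY : Y ∈ homogeneous K L (Fin 3) 1 := tmulX_mem _ _
  have hZ : Z ∈ homogeneous K L (Fin 3) 1 := tmulX_mem _ _
  have h : Λ X Y + Λ (X + Y) Z - (Λ Y Z + Λ X (Y + Z)) = 0 := by
    refine eq_zero_of_homogeneous (p := p) (N := p * 1) (by simp; omega) (sub_mem
      (add_mem (jacobsonLambda_mem_homogeneous hX hY)
        (jacobsonLambda_mem_homogeneous (add_mem hX hY) hZ))
      (add_mem (jacobsonLambda_mem_homogeneous hY hZ)
        (jacobsonLambda_mem_homogeneous hX (add_mem hY hZ)))) ?_ ?_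
    · intro i
      have hD := lTensor_isDerivation (L := L)
        (MvPolynomial.pderiv i : Derivation K (MvPolynomial (Fin 3) K) _)
      rw [map_sub, map_add, map_add, hD.map_jacobsonLambda hp, hD.map_jacobsonLambda hp,
        hD.map_jacobsonLambda hp, hD.map_jacobsonLambda hp, add_assoc X Y Z]
      ring
    · intro i
      simp only [map_sub, map_add, map_jacobsonLambda _ (baseMap_bracket _), X, Y, Z,
        baseMap_killVar_tmulX]
      fin_cases i <;> simp [jacobsonLambda_zero_left, jacobsonLambda_zero_right]
  have h' := congrArg (evalOne K L (Fin 3)) h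
  simp only [map_sub, map_add, map_jacobsonLambda _ (specialize_bracket _), X, Y, Z,
    evalOne_tmulX, map_zero] at h'
  exact sub_eq_zero.mp h'

end Cocycle

end PoissonAlgebra

/-- Twice the correction term for `p`-maps of products: in restricted Poisson algebras,
`2 (x y)^{p} = 2 x ^ p y^{p} + 2 y ^ p x^{p} + leibnizDefect x y`. -/
noncomputable def leibnizDefect {K : Type u} {L : Type v} [Field K] [CommRing L] [Algebra K L]
    (p : ℕ) (br : L →ₗ[K] L →ₗ[K] L) (x y : L) : L :=
  2 * (x ^ p + y ^ p) * jacobsonLambda p br x y - jacobsonLambda p br (x ^ 2) (y ^ 2) -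
    jacobsonLambda p br (x ^ 2 + y ^ 2) (2 * (x * y))

/-- The Hochschild coboundary of `leibnizDefect`, with Frobenius-twisted coefficients. -/
noncomputable def leibnizCoboundary {K : Type u} {L : Type v} [Field K] [CommRing L] [Algebra K L]
    (p : ℕ) (br : L →ₗ[K] L →ₗ[K] L) (x y z : L) : L :=
  x ^ p * leibnizDefect p br y z - leibnizDefect p br (x * y) z +
    leibnizDefect p br x (y * z) - z ^ p * leibnizDefect p br x y

/-! ### The correction term Φ for products: differential, additivity, scaling. -/

namespace PoissonAlgebra

section Frobenius

variable (K : Type u) [Field K] {p : ℕ} [hpr : Fact p.Prime] [CharP K p]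
  {L : Type v} [CommRing L] [Algebra K L]

include K in
theorem add_pow_prime (x y : L) : (x + y) ^ p = x ^ p + y ^ p := by
  rcases subsingleton_or_nontrivial L with _ | _
  · exact Subsingleton.elim _ _
  · have := charP_of_injective_algebraMap (algebraMap K L).injective p
    exact add_pow_char x y p

include K in
theorem two_pow_prime : (2 : L) ^ p = 2 := by
  rw [← one_add_one_eq_two, add_pow_prime K, one_pow]

include K in
theorem cast_prime_eq_zero : (p : L) = 0 := by
  rw [← map_natCast (algebraMap K L), CharP.cast_eq_zero, map_zero]

end Frobenius

section DerivForm

variable {K : Type u} [Field K] {L : Type v} [CommRing L] [Algebra K L] [PoissonAlgebra K L]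

local notation "ad" => PoissonAlgebra.bracket (K := K)

/-- The form `ad_x ^ (p - 1) (D x)`, the formal differential of a `p`-map. -/
noncomputable def derivForm (p : ℕ) (D : L →ₗ[K] L) (x : L) : L :=
  ((ad x : Module.End K L) ^ (p - 1)) (D x)

theorem bracket_sq_pow (x w : L) (n : ℕ) :
    ((ad (x ^ 2) : Module.End K L) ^ n) w = (2 * x) ^ n * ((ad x : Module.End K L) ^ n) w := by
  induction n with
  | zero => simp
  | succ n ih =>
    have h2 : ad x (2 * x) = 0 := by rw [two_mul, map_add, bracket_self, add_zero]
    rw [pow_succ', Module.End.mul_apply, ih, pow_succ' (ad x : Module.End K L),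
      Module.End.mul_apply, bracket_pow_left, leibniz_right, bracket_pow_right, h2]
    simp
    ring

theorem bracket_two_mul_pow (x w : L) (n : ℕ) :
    ((ad (2 * x) : Module.End K L) ^ n) w = 2 ^ n * ((ad x : Module.End K L) ^ n) w := by
  have h : (ad (2 * x) : Module.End K L) = (2 : K) • (ad x : Module.End K L) := by
    rw [two_mul, map_add, two_smul]
  rw [h, smul_pow, LinearMap.smul_apply, Algebra.smul_def,
    _root_.map_pow, map_ofNat]

variable {p : ℕ} [hpr : Fact p.Prime] [CharP K p] {D : L →ₗ[K] L} (hD : IsDerivation K D)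
include hD

theorem IsDerivation.map_two_mul (x : L) : D (2 * x) = 2 * D x := by
  rw [two_mul, map_add, two_mul]

theorem IsDerivation.map_one : D 1 = 0 := by
  have h := hD.map_mul 1 1
  simp only [mul_one, one_mul] at h
  exact left_eq_add.mp h

theorem IsDerivation.map_pow (x : L) (n : ℕ) : D (x ^ n) = n * x ^ (n - 1) * D x := by
  induction n with
  | zero => simp [hD.map_one]
  | succ n ih =>
    rw [pow_succ, hD.map_mul, ih]
    cases n with
    | zero => simp
    | succ n => simp; ring

theorem IsDerivation.map_pow_prime (x : L) : D (x ^ p) = 0 := by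
  rw [hD.map_pow, cast_prime_eq_zero K, zero_mul, zero_mul]

/-- The differentiated form of the rule for squares: ad_{x²} = 2x ad_x, x commutes with ad_x, D
kills x^p, and 2^p = 2. -/
theorem derivForm_sq (x : L) : derivForm p D (x ^ 2) = 2 * x ^ p * derivForm p D x := by
  obtain ⟨q, rfl⟩ := Nat.exists_eq_succ_of_ne_zero hpr.out.ne_zero
  have h2 := two_pow_prime K (p := q + 1) (L := L)
  have hx : ad x (2 * x) = 0 := by rw [two_mul, map_add, bracket_self, add_zero]
  have hm : ∀ n, ((ad x : Module.End K L) ^ n) (2 * x * D x) =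
      2 * x * ((ad x : Module.End K L) ^ n) (D x) := by
    intro n
    induction n with
    | zero => simp
    | succ n ih =>
      rw [pow_succ', Module.End.mul_apply, ih, leibniz_right, hx, Module.End.mul_apply]
      ring
  rw [derivForm, derivForm, bracket_sq_pow, hD.map_pow]
  simp only [Nat.succ_eq_add_one, Nat.add_sub_cancel, Nat.cast_ofNat] at h2 ⊢
  rw [show 2 - 1 = 1 from rfl, pow_one, hm]
  linear_combination x ^ (q + 1) * ((ad x : Module.End K L) ^ q) (D x) * h2

theorem derivForm_two_mul (x : L) : derivForm p D (2 * x) = 2 * derivForm p D x := by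
  obtain ⟨q, rfl⟩ := Nat.exists_eq_succ_of_ne_zero hpr.out.ne_zero
  have h2 := two_pow_prime K (p := q + 1) (L := L)
  rw [derivForm, derivForm, bracket_two_mul_pow, hD.map_two_mul, two_mul (D x),
    map_add]
  simp only [Nat.succ_eq_add_one, Nat.add_sub_cancel] at h2 ⊢
  linear_combination ((ad x : Module.End K L) ^ q) (D x) * h2

variable (hp : 3 ≤ p)
include hp

theorem IsDerivation.map_jacobsonLambda_eq_derivForm (x y : L) : D (jacobsonLambda p ad x y) =
    derivForm p D (x + y) - derivForm p D x - derivForm p D y := hD.map_jacobsonLambda hp x y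

/-- Φ compares the p-th power of (x + y)² with that of its expansion, so its differential is the
failure of the product rule for ω. -/
theorem IsDerivation.map_leibnizDefect (x y : L) : D (leibnizDefect p ad x y) =
    2 * (derivForm p D (x * y) - x ^ p * derivForm p D y - y ^ p * derivForm p D x) := by
  have h := hD.map_jacobsonLambda_eq_derivForm hp
  have h0 : D (2 * (x ^ p + y ^ p)) = 0 := by
    rw [hD.map_two_mul, map_add, hD.map_pow_prime, hD.map_pow_prime]; ring
  have hs : x ^ 2 + y ^ 2 + 2 * (x * y) = (x + y) ^ 2 := by ring
  rw [leibnizDefect, map_sub, map_sub, hD.map_mul, h0, h, h, h, hs, derivForm_sq hD,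
    derivForm_sq hD, derivForm_sq hD, derivForm_two_mul hD, add_pow_prime K]
  ring

end DerivForm

section Defect

variable {K : Type u} [Field K] {L : Type v} [CommRing L] [Algebra K L] [PoissonAlgebra K L]
  {p : ℕ} [hpr : Fact p.Prime] [CharP K p]

local notation "ad" => PoissonAlgebra.bracket (K := K)
local notation "Λ" => jacobsonLambda p (PoissonAlgebra.bracket (K := K))
local notation "Φ" => leibnizDefect p (PoissonAlgebra.bracket (K := K))
local notation "H" => leibnizCoboundary p (PoissonAlgebra.bracket (K := K))

theorem map_leibnizDefect {M : Type w} [CommRing M] [Algebra K M] [PoissonAlgebra K M]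
    (f : L →ₐ[K] M) (hf : ∀ x y, f (ad x y) = ad (f x) (f y)) (x y : L) :
    f (Φ x y) = Φ (f x) (f y) := by
  simp only [leibnizDefect, map_sub, map_mul, map_add, map_pow, map_ofNat,
    map_jacobsonLambda f hf]

theorem jacobsonLambda_eq_zero_of_bracket {x y : L} (h : ad x y = 0) : Λ x y = 0 :=
  jacobsonLambda_eq_zero _ hpr.out.two_le (bracket_self x) (bracket_eq_zero_symm h)

theorem leibnizDefect_eq_zero {x y : L} (h : ad x y = 0) : Φ x y = 0 := by
  have h1 : ad (x ^ 2) (y ^ 2) = 0 := by rw [bracket_pow_left, bracket_pow_right, h]; ring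
  have h2 : ad (x ^ 2 + y ^ 2) (2 * (x * y)) = 0 := by
    rw [two_mul, map_add, map_add, LinearMap.add_apply, bracket_pow_left, bracket_pow_left,
      leibniz_right, leibniz_right, bracket_self, bracket_self, h, bracket_eq_zero_symm h]
    ring
  rw [leibnizDefect, jacobsonLambda_eq_zero_of_bracket h, jacobsonLambda_eq_zero_of_bracket h1,
    jacobsonLambda_eq_zero_of_bracket h2]
  ring

theorem leibnizDefect_one_left (x : L) : Φ 1 x = 0 := leibnizDefect_eq_zero (bracket_one_left x)

theorem leibnizDefect_one_right (x : L) : Φ x 1 = 0 := leibnizDefect_eq_zero (bracket_one_right x)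

theorem leibnizDefect_zero_left (x : L) : Φ 0 x = 0 := leibnizDefect_eq_zero (by simp)

theorem leibnizDefect_zero_right (x : L) : Φ x 0 = 0 := leibnizDefect_eq_zero (by simp)

theorem leibnizDefect_comm (hp : 3 ≤ p) (x y : L) : Φ x y = Φ y x := by
  rw [leibnizDefect, leibnizDefect, jacobsonLambda_comm hp x y,
    jacobsonLambda_comm hp (x ^ 2) (y ^ 2), add_comm (x ^ p), add_comm (x ^ 2), mul_comm x y]

theorem leibnizDefect_mem_homogeneous {σ : Type w} {n : ℕ} {ξ η : L ⊗[K] MvPolynomial σ K}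
    (hξ : ξ ∈ homogeneous K L σ n) (hη : η ∈ homogeneous K L σ n) :
    Φ ξ η ∈ homogeneous K L σ (p * (2 * n)) := by
  have h1 : 2 * (ξ ^ p + η ^ p) * Λ ξ η ∈ homogeneous K L σ (p * (2 * n)) := by
    have h := add_mem (pow_mem_homogeneous hξ p) (pow_mem_homogeneous hη p)
    have := mul_mem_homogeneous (add_mem h h) (jacobsonLambda_mem_homogeneous hξ hη)
    rwa [show p * n + p * n = p * (2 * n) by ring, ← two_mul] at this
  have h2 := jacobsonLambda_mem_homogeneous (p := p) (pow_mem_homogeneous hξ 2)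
    (pow_mem_homogeneous hη 2)
  have h3 : Λ (ξ ^ 2 + η ^ 2) (2 * (ξ * η)) ∈ homogeneous K L σ (p * (2 * n)) := by
    refine jacobsonLambda_mem_homogeneous
      (add_mem (pow_mem_homogeneous hξ 2) (pow_mem_homogeneous hη 2)) ?_
    have h := mul_mem_homogeneous hξ hη
    rw [← two_mul] at h
    rw [two_mul (ξ * η)]
    exact add_mem h h
  exact sub_mem (sub_mem h1 h2) h3

variable (hp : 3 ≤ p)
include hp

/-- The failure of additivity is exactly what 2γ(xz) and 2z^p γ(x) produce for a `p`-map γ; this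
makes `productDefect` biadditive. The degree count is 2p < 3p. -/
theorem leibnizDefect_add_left (x y z : L) :
    Φ (x + y) z = Φ x z + Φ y z + 2 * Λ (x * z) (y * z) - 2 * (z ^ p * Λ x y) := by
  set X := tmulX K x (0 : Fin 3)
  set Y := tmulX K y (1 : Fin 3)
  set Z := tmulX K z (2 : Fin 3)
  have hX : X ∈ homogeneous K L (Fin 3) 1 := tmulX_mem _ _
  have hY : Y ∈ homogeneous K L (Fin 3) 1 := tmulX_mem _ _
  have hZ : Z ∈ homogeneous K L (Fin 3) 1 := tmulX_mem _ _
  have h : Φ (X + Y) Z - (Φ X Z + Φ Y Z + 2 * Λ (X * Z) (Y * Z) - 2 * (Z ^ p * Λ X Y)) = 0 := by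
    refine eq_zero_of_homogeneous (p := p) (N := p * (2 * 1)) (by simp; omega) ?_ ?_ ?_
    · have h1 := jacobsonLambda_mem_homogeneous (p := p) (mul_mem_homogeneous hX hZ)
        (mul_mem_homogeneous hY hZ)
      have h2 := mul_mem_homogeneous (pow_mem_homogeneous hZ p)
        (jacobsonLambda_mem_homogeneous (p := p) hX hY)
      rw [← mul_add, ← two_mul] at h2
      rw [← two_mul] at h1
      rw [two_mul (Λ (X * Z) (Y * Z)), two_mul (Z ^ p * Λ X Y)]
      exact sub_mem (leibnizDefect_mem_homogeneous (add_mem hX hY) hZ)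
        (sub_mem (add_mem (add_mem (leibnizDefect_mem_homogeneous hX hZ)
          (leibnizDefect_mem_homogeneous hY hZ)) (add_mem h1 h1)) (add_mem h2 h2))
    · intro i
      have hD := lTensor_isDerivation (L := L)
        (MvPolynomial.pderiv i : Derivation K (MvPolynomial (Fin 3) K) _)
      have hΛ := hD.map_jacobsonLambda_eq_derivForm hp
      rw [map_sub, map_sub, map_add, map_add, hD.map_two_mul, hD.map_two_mul, hD.map_mul,
        hD.map_pow_prime, hD.map_leibnizDefect hp, hD.map_leibnizDefect hp,
        hD.map_leibnizDefect hp, hΛ, hΛ, add_mul, add_pow_prime K]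
      ring
    · intro i
      simp only [map_sub, map_add, map_mul, map_pow, map_ofNat,
        map_jacobsonLambda _ (baseMap_bracket _), map_leibnizDefect _ (baseMap_bracket _), X, Y, Z,
        baseMap_killVar_tmulX]
      have hp0 : p ≠ 0 := hpr.out.ne_zero
      fin_cases i <;> simp [jacobsonLambda_zero_left, jacobsonLambda_zero_right,
        leibnizDefect_zero_left, leibnizDefect_zero_right, hp0]
  have h' := congrArg (evalOne K L (Fin 3)) h
  simp only [map_sub, map_add, map_mul, map_pow, map_ofNat,
    map_jacobsonLambda _ (specialize_bracket _), map_leibnizDefect _ (specialize_bracket _),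
    X, Y, Z, evalOne_tmulX, map_zero] at h'
  exact sub_eq_zero.mp h'

theorem leibnizDefect_add_right (x y z : L) :
    Φ x (y + z) = Φ x y + Φ x z + 2 * Λ (x * y) (x * z) - 2 * (x ^ p * Λ y z) := by
  rw [leibnizDefect_comm hp, leibnizDefect_add_left hp, leibnizDefect_comm hp y x,
    leibnizDefect_comm hp z x, mul_comm y x, mul_comm z x]

theorem derivForm_tmul {C : Type w} [CommRing C] [Algebra K C] [PoissonAlgebra K C]
    [HasZeroBracket K C] (d : Derivation K C C) (x : L) (f : C) :
    derivForm p (LinearMap.lTensor L (d : C →ₗ[K] C)) (x ⊗ₜ[K] f) = 0 := by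
  obtain ⟨q, rfl⟩ : ∃ q, p = q + 2 := ⟨p - 2, by omega⟩
  rw [derivForm, show q + 2 - 1 = q + 1 from rfl, pow_succ, Module.End.mul_apply,
    LinearMap.lTensor_tmul, bracket_tmul_of_hasZeroBracket, bracket_self,
    TensorProduct.zero_tmul, map_zero]

/-- With only two variables the degree 2p meets the bound of the vanishing criterion, and exactly
one monomial survives. -/
theorem leibnizDefect_tmulX (x y : L) :
    Φ (tmulX K x (0 : Fin 2)) (tmulX K y (1 : Fin 2)) =
      Φ x y ⊗ₜ (MvPolynomial.X 0 ^ p * MvPolynomial.X 1 ^ p) := by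
  set ξ := Φ (tmulX K x (0 : Fin 2)) (tmulX K y (1 : Fin 2)) with hξdef
  set m₀ : Fin 2 →₀ ℕ := Finsupp.single 0 p + Finsupp.single 1 p
  have hmon : (MvPolynomial.X 0 ^ p * MvPolynomial.X 1 ^ p : MvPolynomial (Fin 2) K) =
      MvPolynomial.monomial m₀ 1 := by
    simp [m₀, MvPolynomial.X_pow_eq_monomial, MvPolynomial.monomial_mul]
  -- A derivation of the coefficients sends a pure tensor x ⊗ f to some x ⊗ g, on which its adjoint
  -- operator vanishes.
  have hD : ∀ i, partialDeriv L i ξ = 0 := by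
    intro i
    rw [(lTensor_isDerivation (L := L) (MvPolynomial.pderiv i :
      Derivation K (MvPolynomial (Fin 2) K) _)).map_leibnizDefect hp,
      Algebra.TensorProduct.tmul_mul_tmul, derivForm_tmul hp, derivForm_tmul hp,
      derivForm_tmul hp]
    simp
  have h0 : ∀ i, baseMap L (killVar i) ξ = 0 := by
    intro i
    rw [hξdef, map_leibnizDefect _ (baseMap_bracket _), baseMap_killVar_tmulX,
      baseMap_killVar_tmulX]
    fin_cases i <;> simp [leibnizDefect_zero_left, leibnizDefect_zero_right]
  have hξ : ξ = slice L (MvPolynomial.lcoeff K m₀) ξ ⊗ₜ[K] MvPolynomial.monomial m₀ 1 := by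
    refine sub_eq_zero.mp (eq_zero_of_slice fun m => ?_)
    rw [map_sub, slice_tmul, MvPolynomial.lcoeff_apply, MvPolynomial.coeff_monomial]
    split_ifs with hm
    · rw [hm, one_smul, sub_self]
    rw [zero_smul, sub_zero]
    by_cases hdeg : m.degree = p * (2 * 1)
    · by_contra hne
      have hmi : ∀ i, p ≤ m i := by
        intro i
        by_contra! hlt
        by_cases hi : m i = 0
        · exact hne (slice_eq_zero_of_killVar (h0 i) hi)
        · exact hne (slice_eq_zero_of_not_dvd (p := p) (hD i) fun hdvd =>
            absurd (Nat.le_of_dvd (Nat.pos_of_ne_zero hi) hdvd) (by omega))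
      rw [Finsupp.degree_eq_sum, Fin.sum_univ_two] at hdeg
      have := hmi 0
      have := hmi 1
      apply hm
      ext i
      fin_cases i <;> simp [m₀] <;> omega
    · exact slice_eq_zero_of_homogeneous
        (leibnizDefect_mem_homogeneous (tmulX_mem _ _) (tmulX_mem _ _)) hdeg
  -- Setting the variables to 1 identifies the coefficient of the surviving monomial.
  have h1 := congrArg (evalOne K L (Fin 2)) hξ
  rw [← hmon, specialize_tmul, hξdef, map_leibnizDefect _ (specialize_bracket _), evalOne_tmulX,
    evalOne_tmulX, ← hξdef] at h1
  rw [hξ, hmon]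
  congr 1
  simpa using h1.symm

theorem leibnizDefect_tmul {C : Type w} [CommRing C] [Algebra K C] [PoissonAlgebra K C]
    [HasZeroBracket K C] (x y : L) (f g : C) :
    Φ (x ⊗ₜ[K] f) (y ⊗ₜ[K] g) = Φ x y ⊗ₜ (f ^ p * g ^ p) := by
  have h := congrArg (baseMap L
    (MvPolynomial.aeval ![f, g] : MvPolynomial (Fin 2) K →ₐ[K] C)) (leibnizDefect_tmulX hp x y)
  rw [map_leibnizDefect _ (baseMap_bracket _)] at h
  simpa using h

theorem leibnizCoboundary_tmul {C : Type w} [CommRing C] [Algebra K C] [PoissonAlgebra K C]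
    [HasZeroBracket K C] (x y z : L) (f g h : C) :
    H (x ⊗ₜ[K] f) (y ⊗ₜ[K] g) (z ⊗ₜ[K] h) = H x y z ⊗ₜ (f ^ p * g ^ p * h ^ p) := by
  simp only [leibnizCoboundary, Algebra.TensorProduct.tmul_mul_tmul, leibnizDefect_tmul hp,
    Algebra.TensorProduct.tmul_pow, TensorProduct.sub_tmul, TensorProduct.add_tmul, mul_pow]
  simp only [mul_comm, mul_assoc]

/-- The Λ terms from the non-additivity of Φ cancel in the alternating sum. -/
theorem leibnizCoboundary_add_left (x x' y z : L) : H (x + x') y z = H x y z + H x' y z := by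
  simp only [leibnizCoboundary, add_mul, leibnizDefect_add_left hp, add_pow_prime K, ← mul_assoc,
    mul_pow]
  ring

theorem leibnizCoboundary_symm (x y z : L) : H z y x = - H x y z := by
  simp only [leibnizCoboundary]
  rw [leibnizDefect_comm hp (z * y) x, leibnizDefect_comm hp z (y * x), leibnizDefect_comm hp y x,
    leibnizDefect_comm hp z y, mul_comm z y, mul_comm y x]
  ring

theorem leibnizCoboundary_add_right (x y z z' : L) : H x y (z + z') = H x y z + H x y z' := by
  rw [leibnizCoboundary_symm hp (z + z') y x, leibnizCoboundary_add_left hp,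
    leibnizCoboundary_symm hp z y x, leibnizCoboundary_symm hp z' y x]
  ring

theorem leibnizCoboundary_add_mid (x y y' z : L) : H x (y + y') z = H x y z + H x y' z := by
  simp only [leibnizCoboundary, add_mul, mul_add, leibnizDefect_add_left hp,
    leibnizDefect_add_right hp, ← mul_assoc]
  ring

omit hp in
theorem leibnizCoboundary_one_left (y z : L) : H 1 y z = 0 := by
  simp [leibnizCoboundary, leibnizDefect_one_left]

omit hp in
theorem leibnizCoboundary_one_mid (x z : L) : H x 1 z = 0 := by
  simp [leibnizCoboundary, leibnizDefect_one_left, leibnizDefect_one_right]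

omit hp in
theorem leibnizCoboundary_one_right (x y : L) : H x y 1 = 0 := by
  simp [leibnizCoboundary, leibnizDefect_one_right]

end Defect

end PoissonAlgebra

namespace PoissonAlgebra

/-! ### Φ is a Hochschild cocycle. -/

section Subalgebra

variable {K : Type u} [Field K] {L : Type v} [CommRing L] [Algebra K L] [PoissonAlgebra K L]
  {p : ℕ} [hpr : Fact p.Prime] [CharP K p]

local notation "ad" => PoissonAlgebra.bracket (K := K)
local notation "Λ" => jacobsonLambda p (PoissonAlgebra.bracket (K := K))
local notation "Φ" => leibnizDefect p (PoissonAlgebra.bracket (K := K))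
local notation "H" => leibnizCoboundary p (PoissonAlgebra.bracket (K := K))

theorem bracket_mem_adjoin {s : Set L} (hs : ∀ x ∈ s, ∀ y ∈ s, ad x y ∈ Algebra.adjoin K s)
    {x y : L} (hx : x ∈ Algebra.adjoin K s) (hy : y ∈ Algebra.adjoin K s) :
    ad x y ∈ Algebra.adjoin K s := by
  have halg : ∀ (c : K) (z : L), ad (algebraMap K L c) z = 0 := by
    intro c z
    rw [Algebra.algebraMap_eq_smul_one, map_smul, LinearMap.smul_apply, bracket_one_left,
      smul_zero]
  induction hx using Algebra.adjoin_induction with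
  | algebraMap c => rw [halg]; exact zero_mem _
  | add a b _ _ ha hb => rw [map_add, LinearMap.add_apply]; exact add_mem ha hb
  | mul a b ha' hb' ha hb =>
    rw [leibniz]
    exact add_mem (mul_mem ha' hb) (mul_mem hb' ha)
  | mem a ha =>
    induction hy using Algebra.adjoin_induction with
    | algebraMap c => rw [bracket_eq_zero_symm (halg _ _)]; exact zero_mem _
    | add a b _ _ ha hb => rw [map_add]; exact add_mem ha hb
    | mul a b ha' hb' ha hb =>
      rw [leibniz_right]
      exact add_mem (mul_mem ha' hb) (mul_mem hb' ha)
    | mem b hb => exact hs a ha b hb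

theorem leibnizDefect_mem {S : Subalgebra K L} (hS : ∀ x ∈ S, ∀ y ∈ S, ad x y ∈ S)
    {x y : L} (hx : x ∈ S) (hy : y ∈ S) : Φ x y ∈ S := by
  have hΛ : ∀ {x y : L}, x ∈ S → y ∈ S → Λ x y ∈ S := fun hx hy =>
    jacobsonLambda_mem_of_closed _ (Subalgebra.toSubmodule S) hS hpr.out.pos hx hy
  have h2 : (2 : L) ∈ S := ofNat_mem S 2
  exact sub_mem (sub_mem (mul_mem (mul_mem h2 (add_mem (pow_mem hx p) (pow_mem hy p)))
    (hΛ hx hy)) (hΛ (pow_mem hx 2) (pow_mem hy 2)))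
    (hΛ (add_mem (pow_mem hx 2) (pow_mem hy 2)) (mul_mem h2 (mul_mem hx hy)))

theorem leibnizCoboundary_mem {S : Subalgebra K L} (hS : ∀ x ∈ S, ∀ y ∈ S, ad x y ∈ S)
    {x y z : L} (hx : x ∈ S) (hy : y ∈ S) (hz : z ∈ S) :
    H x y z ∈ S :=
  sub_mem (add_mem (sub_mem (mul_mem (pow_mem hx p) (leibnizDefect_mem hS hy hz))
    (leibnizDefect_mem hS (mul_mem hx hy) hz)) (leibnizDefect_mem hS hx (mul_mem hy hz)))
    (mul_mem (pow_mem hz p) (leibnizDefect_mem hS hx hy))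

/-- The coboundary of three elements lies in every Poisson subalgebra that is stable under their
adjoint operators and contains their mutual brackets. -/
theorem leibnizCoboundary_mem_of_stable {S : Subalgebra K L} (hS : ∀ x ∈ S, ∀ y ∈ S, ad x y ∈ S)
    (hp : 3 ≤ p) (x : Fin 3 → L)
    (hx : ∀ i, ∀ c ∈ S, ad (x i) c ∈ S) (hxx : ∀ i j, ad (x i) (x j) ∈ S) :
    H (x 0) (x 1) (x 2) ∈ S := by
  -- Adding a central variable to each x i leaves all brackets unchanged, so S and the X i generate
  -- a Poisson subalgebra that contains their coboundary.
  set X : Fin 3 → L ⊗[K] MvPolynomial (Fin 3) K :=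
    fun i => x i ⊗ₜ 1 + 1 ⊗ₜ MvPolynomial.X i with hX
  set s : Set (L ⊗[K] MvPolynomial (Fin 3) K) :=
    ((fun c => c ⊗ₜ[K] (1 : MvPolynomial (Fin 3) K)) '' S) ∪ Set.range X with hs
  have hcs : ∀ c ∈ S, c ⊗ₜ[K] (1 : MvPolynomial (Fin 3) K) ∈ Algebra.adjoin K s :=
    fun c hc => Algebra.subset_adjoin (Or.inl ⟨c, hc, rfl⟩)
  have hXs : ∀ i, X i ∈ Algebra.adjoin K s := fun i => Algebra.subset_adjoin (Or.inr ⟨i, rfl⟩)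
  have hXc : ∀ i c, ad (X i) (c ⊗ₜ[K] (1 : MvPolynomial (Fin 3) K)) = ad (x i) c ⊗ₜ 1 := by
    intro i c
    rw [hX, map_add, LinearMap.add_apply, bracket_tmul_of_hasZeroBracket,
      bracket_tmul_of_hasZeroBracket, bracket_one_left]
    simp
  have hcl : ∀ a ∈ s, ∀ b ∈ s, ad a b ∈ Algebra.adjoin K s := by
    rintro _ (⟨c, hc, rfl⟩ | ⟨i, rfl⟩) _ (⟨d, hd, rfl⟩ | ⟨j, rfl⟩)
    · simp only [bracket_tmul_of_hasZeroBracket, mul_one]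
      exact hcs _ (hS c hc d hd)
    · rw [bracket_skew, hXc]
      exact neg_mem (hcs _ (hx j c hc))
    · rw [hXc]
      exact hcs _ (hx i d hd)
    · have : ad (X i) (X j) = ad (x i) (x j) ⊗ₜ 1 := by
        simp [hX, bracket_tmul_of_hasZeroBracket, bracket_one_left, bracket_one_right]
      rw [this]
      exact hcs _ (hxx i j)
  -- Sending the i-th variable to -x i kills X i, so τ maps that subalgebra into S.
  set τ : L ⊗[K] MvPolynomial (Fin 3) K →ₐ[K] L :=
    Algebra.TensorProduct.lift (AlgHom.id K L) (MvPolynomial.aeval fun i => - x i)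
      fun _ _ => .all _ _ with hτ
  have hle : Algebra.adjoin K s ≤ S.comap τ := by
    refine Algebra.adjoin_le ?_
    rintro _ (⟨c, hc, rfl⟩ | ⟨i, rfl⟩)
    · simpa [hτ] using hc
    · simp [hτ, hX]
  have hmem := hle (leibnizCoboundary_mem (p := p) (S := Algebra.adjoin K s)
    (fun a ha b hb => bracket_mem_adjoin hcl ha hb) (hXs 0) (hXs 1) (hXs 2))
  -- By trilinearity: every term containing a variable has an entry with 1 in L, and the coboundary
  -- vanishes there.
  have hH : H (X 0) (X 1) (X 2) = H (x 0) (x 1) (x 2) ⊗ₜ 1 := by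
    simp only [hX, leibnizCoboundary_add_left hp, leibnizCoboundary_add_mid hp,
      leibnizCoboundary_add_right hp, leibnizCoboundary_tmul hp, leibnizCoboundary_one_left,
      leibnizCoboundary_one_mid, leibnizCoboundary_one_right]
    simp
  rw [hH, Subalgebra.mem_comap] at hmem
  simpa [hτ] using hmem

end Subalgebra

section Vanishing

variable {K : Type u} [Field K] {L : Type v} [CommRing L] [Algebra K L] [PoissonAlgebra K L]
  {p : ℕ} [hpr : Fact p.Prime] [CharP K p]

local notation "ad" => PoissonAlgebra.bracket (K := K)
local notation "Φ" => leibnizDefect p (PoissonAlgebra.bracket (K := K))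
local notation "H" => leibnizCoboundary p (PoissonAlgebra.bracket (K := K))

theorem leibnizDefect_scale (c : L) (hc : ∀ x, ad c x = 0) (x y : L) :
    leibnizDefect p (scale c hc).bracket x y = c ^ (p - 1) * Φ x y := by
  simp only [leibnizDefect, jacobsonLambda_scale]
  ring

theorem leibnizCoboundary_scale (c : L) (hc : ∀ x, ad c x = 0) (x y z : L) :
    leibnizCoboundary p (scale c hc).bracket x y z = c ^ (p - 1) * H x y z := by
  simp only [leibnizCoboundary, leibnizDefect_scale]
  ring

open LaurentPolynomial in
/-- `leibnizDefect` is a Hochschild cocycle. -/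
theorem leibnizCoboundary_eq_zero (hp : 3 ≤ p) (x y z : L) : H x y z = 0 := by
  -- The bracket is multiplied by the central T². Then ad of a T⁻¹ preserves L[T], and two such
  -- elements bracket into degree 0, so the subalgebra S = L[T] qualifies.
  have hc : ∀ ξ : L ⊗[K] LaurentPolynomial K,
      ad ((1 : L) ⊗ₜ[K] (T 2 : LaurentPolynomial K)) ξ = 0 := by
    intro ξ
    induction ξ with
    | zero => simp
    | add a b ha hb => rw [map_add, ha, hb, add_zero]
    | tmul a f => rw [bracket_tmul_of_hasZeroBracket, bracket_one_left, TensorProduct.zero_tmul]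
  set ι : L ⊗[K] K[X] →ₐ[K] L ⊗[K] LaurentPolynomial K := baseMap L Polynomial.toLaurentAlg
    with hι
  have hX : ∀ (n : ℕ) (a : L) (f : K[X]), a ⊗ₜ[K] (T n * Polynomial.toLaurent f) ∈ ι.range := by
    intro n a f
    refine ⟨a ⊗ₜ (Polynomial.X ^ n * f), ?_⟩
    simp [hι, Polynomial.toLaurentAlg_apply]
  have hr : ∀ ξ ∈ ι.range, ∀ η ∈ ι.range, (scale _ hc).bracket ξ η ∈ ι.range := by
    rintro _ ⟨ξ, rfl⟩ _ ⟨η, rfl⟩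
    change (1 : L) ⊗ₜ[K] (T 2 : LaurentPolynomial K) * ad (ι ξ) (ι η) ∈ ι.range
    rw [← baseMap_bracket]
    refine mul_mem ?_ ⟨_, rfl⟩
    simpa using hX 2 1 1
  have hxr : ∀ (a : L), ∀ ξ ∈ ι.range,
      (scale _ hc).bracket (a ⊗ₜ (T (-1) : LaurentPolynomial K)) ξ ∈ ι.range := by
    rintro a _ ⟨ξ, rfl⟩
    rw [scale_bracket]
    change _ * ad _ (ι ξ) ∈ _
    induction ξ with
    | zero => simp
    | add ξ η h h' => rw [map_add, map_add, mul_add]; exact add_mem h h'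
    | tmul b f =>
      have : (T 2 : LaurentPolynomial K) * (T (-1) * Polynomial.toLaurent f) =
          T (1 : ℕ) * Polynomial.toLaurent f := by
        rw [← mul_assoc, ← T_add]; norm_num
      simp only [hι, Algebra.TensorProduct.map_tmul, AlgHom.id_apply,
        Polynomial.toLaurentAlg_apply, bracket_tmul_of_hasZeroBracket,
        Algebra.TensorProduct.tmul_mul_tmul, one_mul, this]
      exact hX _ _ _
  have hxx : ∀ a b : L, (scale _ hc).bracket (a ⊗ₜ (T (-1) : LaurentPolynomial K))
      (b ⊗ₜ (T (-1) : LaurentPolynomial K)) ∈ ι.range := by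
    intro a b
    rw [scale_bracket, bracket_tmul_of_hasZeroBracket, Algebra.TensorProduct.tmul_mul_tmul,
      ← T_add, ← T_add]
    simpa using hX 0 (ad a b) 1
  have hmem := @leibnizCoboundary_mem_of_stable K _ (L ⊗[K] LaurentPolynomial K) _ _
    (scale _ hc) p _ _ ι.range hr hp ![x ⊗ₜ T (-1), y ⊗ₜ T (-1), z ⊗ₜ T (-1)]
    (fun i => by fin_cases i <;> exact hxr _) (fun i j => by
      fin_cases i <;> fin_cases j <;> exact hxx _ _)
  rw [leibnizCoboundary_scale] at hmem
  obtain ⟨ζ, hζ⟩ := hmem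
  simp only [Matrix.cons_val_zero, Matrix.cons_val_one, Matrix.cons_val,
    leibnizCoboundary_tmul hp, Algebra.TensorProduct.tmul_pow, one_pow,
    Algebra.TensorProduct.tmul_mul_tmul, one_mul, T_pow, ← T_add] at hζ
  have hinj : Function.Injective ι :=
    Module.Flat.lTensor_preserves_injective_linearMap (M := L)
      (Polynomial.toLaurentAlg (R := K)).toLinearMap Polynomial.toLaurent_injective
  -- The p - 1 scaled brackets give T^(2(p-1)), and three entries of weight p give T^(-3p). So the
  -- coboundary times T^(-(p+2)) lies in L[T], which forces it to vanish.
  have hdeg : ((p - 1 : ℕ) : ℤ) * 2 + (p * -1 + p * -1 + p * -1) = -((p + 2 : ℕ) : ℤ) := by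
    push_cast [Nat.cast_sub hpr.out.one_lt.le]; ring
  have h1 : H x y z ⊗ₜ[K] (1 : K[X]) = (1 : L) ⊗ₜ[K] (Polynomial.X ^ (p + 2) : K[X]) * ζ := by
    apply hinj
    rw [map_mul]
    erw [hζ]
    rw [hdeg]
    simp only [hι, Algebra.TensorProduct.map_tmul, AlgHom.id_apply, Polynomial.toLaurentAlg_apply,
      map_one, map_pow, Polynomial.toLaurent_X, Algebra.TensorProduct.tmul_mul_tmul, one_mul,
      T_pow, ← T_add]
    simp
  -- Setting T = 0 kills the right-hand side.
  have h2 := congrArg (specialize L (Polynomial.aeval (0 : K))) h1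
  rw [map_mul, specialize_tmul, specialize_tmul] at h2
  simpa using h2

end Vanishing

end PoissonAlgebra

namespace PoissonAlgebra

/-! ### The extension of L by its Frobenius twist. -/

section Extension

variable (K : Type u) [Field K] (p : ℕ) (L : Type v) [CommRing L] [Algebra K L]
  [PoissonAlgebra K L]

/-- The extension of `L` by its Frobenius twist defined by the cocycle `Λ_p`. Its linear sections
are the maps satisfying the algebraic identities of a `p`-map. -/
@[ext]
structure PMapExtension (K : Type u) (p : ℕ) (L : Type v) : Type v where
  base : L
  value : L

namespace PMapExtension

variable {K p L}

local notation "Λ" => jacobsonLambda p (PoissonAlgebra.bracket (K := K) (A := L))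

noncomputable instance : Add (PMapExtension K p L) :=
  ⟨fun x y => ⟨x.base + y.base, x.value + y.value + Λ x.base y.base⟩⟩
instance : Zero (PMapExtension K p L) := ⟨⟨0, 0⟩⟩
instance : Neg (PMapExtension K p L) := ⟨fun x => ⟨-x.base, -x.value⟩⟩
instance : SMul K (PMapExtension K p L) := ⟨fun c x => ⟨c • x.base, c ^ p • x.value⟩⟩

theorem add_base (x y : PMapExtension K p L) : (x + y).base = x.base + y.base := rfl
theorem add_value (x y : PMapExtension K p L) :
    (x + y).value = x.value + y.value + Λ x.base y.base := rfl
theorem zero_base : (0 : PMapExtension K p L).base = 0 := rfl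
theorem zero_value : (0 : PMapExtension K p L).value = 0 := rfl
theorem neg_base (x : PMapExtension K p L) : (-x).base = -x.base := rfl
theorem neg_value (x : PMapExtension K p L) : (-x).value = -x.value := rfl
theorem smul_base (c : K) (x : PMapExtension K p L) : (c • x).base = c • x.base := rfl
theorem smul_value (c : K) (x : PMapExtension K p L) : (c • x).value = c ^ p • x.value := rfl

variable [hpr : Fact p.Prime] [CharP K p] [hp : Fact (3 ≤ p)]

noncomputable instance : AddCommGroup (PMapExtension K p L) where
  add_assoc x y z := by
    ext
    · simp only [add_base, add_assoc]
    · simp only [add_base, add_value]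
      linear_combination jacobsonLambda_cocycle (K := K) hp.out x.base y.base z.base
  zero_add x := by
    ext <;> simp [add_base, add_value, zero_base, zero_value, jacobsonLambda_zero_left]
  add_zero x := by
    ext <;> simp [add_base, add_value, zero_base, zero_value, jacobsonLambda_zero_right]
  neg_add_cancel x := by
    ext
    · simp [add_base, neg_base, zero_base]
    · rw [add_value, neg_base, neg_value, zero_value,
        jacobsonLambda_eq_zero_of_bracket (by simp [bracket_self])]
      simp
  add_comm x y := by
    ext
    · simp only [add_base, add_comm]
    · simp only [add_value, jacobsonLambda_comm hp.out x.base, add_comm x.value]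
  nsmul := nsmulRec
  zsmul := zsmulRec

theorem jacobsonLambda_smul (c : K) (x y : L) : Λ (c • x) (c • y) = c ^ p • Λ x y := by
  have h : ∀ z : L, bracket (K := K) (algebraMap K L c) z = 0 := by
    intro z
    rw [Algebra.algebraMap_eq_smul_one, map_smul, LinearMap.smul_apply, bracket_one_left,
      smul_zero]
  rw [Algebra.smul_def, Algebra.smul_def, jacobsonLambda_mul hpr.out.pos (h x) (h y),
    Algebra.smul_def, map_pow]

noncomputable instance : Module K (PMapExtension K p L) where
  one_smul x := by ext <;> simp [smul_base, smul_value]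
  mul_smul c d x := by ext <;> simp [smul_base, smul_value, mul_smul, mul_pow]
  smul_zero c := by ext <;> simp [smul_base, smul_value, zero_base, zero_value]
  zero_smul x := by
    ext <;> simp [smul_base, smul_value, zero_base, zero_value, hpr.out.ne_zero]
  smul_add c x y := by
    ext
    · simp [smul_base, add_base]
    · simp [smul_base, smul_value, add_value, jacobsonLambda_smul]
  add_smul c d x := by
    ext
    · simp [smul_base, add_base, add_smul]
    · rw [add_value, smul_value, smul_value, smul_value, smul_base, smul_base,
        jacobsonLambda_eq_zero_of_bracket (by simp [bracket_self]), add_pow_char, add_smul,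
        add_zero]

variable (K p L) in
/-- The projection of the extension. -/
noncomputable def baseHom : PMapExtension K p L →ₗ[K] L where
  toFun := base
  map_add' := add_base
  map_smul' := smul_base

end PMapExtension

end Extension

/-! ### The restricted Lie structure on the tensor product. -/

section TensorPMap

variable {K : Type u} [Field K] {p : ℕ} [hpr : Fact p.Prime] [CharP K p] [hp : Fact (3 ≤ p)]
  {A : Type v} [CommRing A] [Algebra K A] [PoissonAlgebra K A]
  {B : Type w} [CommRing B] [Algebra K B] [PoissonAlgebra K B]

local notation "ad" => PoissonAlgebra.bracket (K := K)
local notation "Λ" => jacobsonLambda p (PoissonAlgebra.bracket (K := K))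

theorem includeLeft_bracket (x y : A) :
    (Algebra.TensorProduct.includeLeft : A →ₐ[K] A ⊗[K] B) (ad x y) =
      ad (Algebra.TensorProduct.includeLeft (R := K) (S := K) (B := B) x)
        (Algebra.TensorProduct.includeLeft (R := K) (S := K) (B := B) y) := by
  simp [bracket_tmul, bracket_self]

theorem includeRight_bracket (x y : B) :
    (Algebra.TensorProduct.includeRight : B →ₐ[K] A ⊗[K] B) (ad x y) =
      ad (Algebra.TensorProduct.includeRight (R := K) (A := A) x)
        (Algebra.TensorProduct.includeRight (R := K) (A := A) y) := by
  simp [bracket_tmul, bracket_self]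

theorem bracket_tmul_one_one_tmul (a : A) (b : B) :
    ad (a ⊗ₜ[K] (1 : B)) ((1 : A) ⊗ₜ[K] b) = 0 := by
  simp [bracket_tmul, bracket_one_left, bracket_one_right]

/-- The element 1 ⊗ b commutes with A ⊗ 1, so it leaves Λ as a p-th power. -/
theorem jacobsonLambda_tmul_left (a a' : A) (b : B) :
    Λ (a ⊗ₜ[K] b) (a' ⊗ₜ[K] b) = Λ a a' ⊗ₜ (b ^ p) := by
  have h := jacobsonLambda_mul (p := p) hpr.out.pos
    (bracket_eq_zero_symm (bracket_tmul_one_one_tmul (K := K) a b))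
    (bracket_eq_zero_symm (bracket_tmul_one_one_tmul (K := K) a' b))
  have h' := map_jacobsonLambda (p := p) _ (includeLeft_bracket (K := K) (A := A) (B := B)) a a'
  simp only [Algebra.TensorProduct.includeLeft_apply] at h'
  rw [← h'] at h
  simpa using h

theorem jacobsonLambda_tmul_right (a : A) (b b' : B) :
    Λ (a ⊗ₜ[K] b) (a ⊗ₜ[K] b') = (a ^ p) ⊗ₜ Λ b b' := by
  have h := jacobsonLambda_mul (p := p) hpr.out.pos
    (bracket_tmul_one_one_tmul (K := K) a b) (bracket_tmul_one_one_tmul (K := K) a b')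
  have h' := map_jacobsonLambda (p := p) _ (includeRight_bracket (K := K) (A := A) (B := B)) b b'
  simp only [Algebra.TensorProduct.includeRight_apply] at h'
  rw [← h'] at h
  simpa using h

/-- Jacobson's formula for adjoint operators. -/
theorem bracket_pow_add (x y : A) : (ad (x + y) : Module.End K A) ^ p =
    (ad x : Module.End K A) ^ p + (ad y : Module.End K A) ^ p + ad (Λ x y) := by
  ext w
  -- For the derivation ad_w the form ω(z) = ad_z^(p-1)[w, z] equals -ad_z^p(w).
  have h := (isDerivation_bracket (K := K) w).map_jacobsonLambda hp.out x y
  have key : ∀ z : A, ((ad z : Module.End K A) ^ (p - 1)) (ad w z) =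
      - ((ad z : Module.End K A) ^ p) w := by
    intro z
    rw [bracket_skew, map_neg, ← Module.End.mul_apply, ← pow_succ,
      Nat.sub_add_cancel hpr.out.one_lt.le]
  rw [key, key, key, bracket_skew] at h
  simp only [LinearMap.add_apply]
  linear_combination h

include K in
theorem add_pow_prime_of_commute {R : Type*} [Ring R] [Algebra K R] {x y : R}
    (h : Commute x y) : (x + y) ^ p = x ^ p + y ^ p := by
  rcases subsingleton_or_nontrivial R with _ | _
  · exact Subsingleton.elim _ _
  · have := charP_of_injective_algebraMap (algebraMap K R).injective p
    exact add_pow_char_of_commute p h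

variable {α : A → A} {β : B → B}

/-- The operator ad_{a⊗b} is the sum of the commuting operators ad_a ⊗ b and a ⊗ ad_b, so p-th
powers add. The cross terms on the right vanish because a^p and b^p are central. -/
theorem bracket_pow_tmul (hα : IsRestrictedLiePMap p (bracket (K := K)) α)
    (hβ : IsRestrictedLiePMap p (bracket (K := K)) β) (a : A) (b : B) :
    (ad (a ⊗ₜ[K] b) : Module.End K (A ⊗[K] B)) ^ p =
      ad (α a ⊗ₜ[K] (b ^ p) + (a ^ p) ⊗ₜ[K] β b) := by
  have hsplit : ∀ (a : A) (b : B), (ad (a ⊗ₜ[K] b) : Module.End K (A ⊗[K] B)) =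
      TensorProduct.map (ad a) (LinearMap.mulLeft K b) +
        TensorProduct.map (LinearMap.mulLeft K a) (ad b) := by
    intro a b
    ext x y
    simp [bracket_tmul]
  have hcomm : Commute (TensorProduct.map (ad a) (LinearMap.mulLeft K b) :
      Module.End K (A ⊗[K] B)) (TensorProduct.map (LinearMap.mulLeft K a) (ad b)) := by
    refine TensorProduct.ext' fun x y => ?_
    simp [leibniz_right, bracket_self]
  have ha : ∀ x : A, ad (a ^ p) x = 0 := fun x => by
    rw [bracket_pow_left, cast_prime_eq_zero K]; ring
  have hb : ∀ x : B, ad (b ^ p) x = 0 := fun x => by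
    rw [bracket_pow_left, cast_prime_eq_zero K]; ring
  rw [hsplit, add_pow_prime_of_commute (K := K) hcomm, TensorProduct.map_pow,
    TensorProduct.map_pow, hα.ad_pow, hβ.ad_pow, LinearMap.pow_mulLeft, LinearMap.pow_mulLeft,
    map_add, hsplit, hsplit]
  ext x y
  simp [ha, hb]

/-- The bilinear map into the extension that lifts to the tensor product `p`-map. -/
noncomputable def tensorPMapExtension (hα : IsRestrictedLiePMap p (bracket (K := K)) α)
    (hβ : IsRestrictedLiePMap p (bracket (K := K)) β) :
    A →ₗ[K] B →ₗ[K] PMapExtension K p (A ⊗[K] B) :=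
  LinearMap.mk₂ K (fun a b => ⟨a ⊗ₜ b, α a ⊗ₜ[K] (b ^ p) + (a ^ p) ⊗ₜ[K] β b⟩)
    (fun a a' b => by
      ext
      · simp [PMapExtension.add_base, TensorProduct.add_tmul]
      · simp only [PMapExtension.add_value, hα.map_add, add_pow_prime K, TensorProduct.add_tmul,
          jacobsonLambda_tmul_left]
        abel)
    (fun c a b => by
      ext
      · simp [PMapExtension.smul_base, TensorProduct.smul_tmul']
      · simp [PMapExtension.smul_value, hα.map_smul, smul_pow, TensorProduct.smul_tmul'])
    (fun a b b' => by
      ext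
      · simp [PMapExtension.add_base, TensorProduct.tmul_add]
      · simp only [PMapExtension.add_value, hβ.map_add, add_pow_prime K, TensorProduct.tmul_add,
          jacobsonLambda_tmul_right]
        abel)
    (fun c a b => by
      ext
      · simp [PMapExtension.smul_base]
      · simp [PMapExtension.smul_value, hβ.map_smul, smul_pow])

/-- The tensor product of two restricted Lie structures. -/
theorem exists_tensor_restrictedLie (hα : IsRestrictedLiePMap p (bracket (K := K)) α)
    (hβ : IsRestrictedLiePMap p (bracket (K := K)) β) :
    ∃ γ : A ⊗[K] B → A ⊗[K] B, IsRestrictedLiePMap p (bracket (K := K)) γ ∧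
      ∀ a b, γ (a ⊗ₜ[K] b) = α a ⊗ₜ[K] (b ^ p) + (a ^ p) ⊗ₜ[K] β b := by
  set s := TensorProduct.lift (tensorPMapExtension hα hβ)
  -- The base of s is the identity on pure tensors, so s is a section and its value obeys the law
  -- for sums.
  have hs : ∀ x, (s x).base = x := by
    have : PMapExtension.baseHom K p (A ⊗[K] B) ∘ₗ s = LinearMap.id :=
      TensorProduct.ext' fun a b => rfl
    exact fun x => LinearMap.congr_fun this x
  have hadd : ∀ x y, (s (x + y)).value = (s x).value + (s y).value + Λ x y := by
    intro x y
    rw [map_add, PMapExtension.add_value, hs, hs]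
  refine ⟨fun x => (s x).value, ⟨fun x => ?_, fun c x => ?_, hadd⟩, fun a b => rfl⟩
  · induction x with
    | zero =>
      simp [PMapExtension.zero_value, zero_pow hpr.out.ne_zero]
    | add x y hx hy => rw [bracket_pow_add, hx, hy, hadd, map_add, map_add]
    | tmul a b => exact bracket_pow_tmul hα hβ a b
  · rw [map_smul, PMapExtension.smul_value]

end TensorPMap

/-! ### The product formula for `p`-maps. -/

section ProductDefect

variable {K : Type u} [Field K] {p : ℕ} [hpr : Fact p.Prime] [CharP K p] [hp : Fact (3 ≤ p)]
  {L : Type v} [CommRing L] [Algebra K L] [PoissonAlgebra K L]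

variable (K p) in
/-- The failure of the product formula for the map `γ`. -/
noncomputable def productDefect (γ : L → L) (x y : L) : L :=
  2 * γ (x * y) - 2 * (x ^ p * γ y) - 2 * (y ^ p * γ x) -
    leibnizDefect p (bracket (K := K)) x y

local notation "ad" => PoissonAlgebra.bracket (K := K)

variable {γ : L → L}

theorem productDefect_comm (x y : L) : productDefect K p γ x y = productDefect K p γ y x := by
  rw [productDefect, productDefect, leibnizDefect_comm hp.out, mul_comm x y]
  ring

/-- The γ terms form a Hochschild coboundary and cancel; what remains is the coboundary of Φ, which
is zero. -/
theorem productDefect_cocycle (x y z : L) :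
    x ^ p * productDefect K p γ y z - productDefect K p γ (x * y) z +
      productDefect K p γ x (y * z) - z ^ p * productDefect K p γ x y = 0 := by
  have h := leibnizCoboundary_eq_zero (K := K) hp.out x y z
  rw [leibnizCoboundary] at h
  simp only [productDefect, mul_assoc x y z, mul_pow]
  linear_combination -h

/-- On the diagonal the defect measures the rule for squares, so its vanishing gives back that axiom
once 2 is inverted. -/
theorem productDefect_self (x : L) :
    productDefect K p γ x x = 2 * (γ (x ^ 2) - 2 * x ^ p * γ x) := by
  rw [productDefect, leibnizDefect_eq_zero (bracket_self x), sq]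
  ring

theorem productDefect_add_left (hγ : IsRestrictedLiePMap p (bracket (K := K)) γ) (x y z : L) :
    productDefect K p γ (x + y) z = productDefect K p γ x z + productDefect K p γ y z := by
  simp only [productDefect, add_mul, hγ.map_add, leibnizDefect_add_left hp.out, add_pow_prime K]
  ring

theorem productDefect_add_right (hγ : IsRestrictedLiePMap p (bracket (K := K)) γ) (x y z : L) :
    productDefect K p γ x (y + z) = productDefect K p γ x y + productDefect K p γ x z := by
  rw [productDefect_comm, productDefect_add_left hγ, productDefect_comm y, productDefect_comm z]

include K hp in
theorem eq_zero_of_two_mul {x : L} (h : 2 * x = 0) : x = 0 := by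
  have h2 : (2 : K) ≠ 0 := by
    have : ((2 : ℕ) : K) ≠ 0 := by
      rw [Ne, CharP.cast_eq_zero_iff K p]
      have := hp.out
      exact fun h => absurd (Nat.le_of_dvd two_pos h) (by omega)
    exact_mod_cast this
  have h' : (2 : K) • x = 0 := by rw [Algebra.smul_def, map_ofNat, h]
  exact (smul_eq_zero.mp h').resolve_left h2

/-- The product formula in a restricted Poisson algebra. -/
theorem productDefect_eq_zero (hγ : IsRestrictedPoissonStructure K p γ) (x y : L) :
    productDefect K p γ x y = 0 := by
  have h0 : ∀ z, productDefect K p γ z z = 0 := fun z => by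
    rw [productDefect_self, hγ.map_sq]; ring
  -- Polarization: a symmetric biadditive map that is zero on the diagonal is zero when 2 is
  -- invertible.
  have h := h0 (x + y)
  rw [productDefect_add_left hγ.isRestrictedLie, productDefect_add_right hγ.isRestrictedLie,
    productDefect_add_right hγ.isRestrictedLie, h0, h0, productDefect_comm y x] at h
  exact eq_zero_of_two_mul (K := K) (p := p) (by linear_combination h)

theorem pmap_one (hγ : IsRestrictedPoissonStructure K p γ) : γ 1 = 0 := by
  have h := hγ.map_sq 1
  simp only [one_pow, mul_one] at h
  linear_combination -h

theorem pmap_zero (hγ : IsRestrictedLiePMap p (bracket (K := K)) γ) : γ 0 = 0 := by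
  have h := hγ.map_smul 0 0
  simpa [hpr.out.ne_zero] using h

theorem map_productDefect {M : Type w} [CommRing M] [Algebra K M] [PoissonAlgebra K M]
    {δ : M → M} (f : L →ₐ[K] M) (hf : ∀ x y, f (ad x y) = ad (f x) (f y))
    (hδ : ∀ x, f (γ x) = δ (f x)) (x y : L) :
    f (productDefect K p γ x y) = productDefect K p δ (f x) (f y) := by
  simp only [productDefect, map_sub, map_mul, map_pow, map_ofNat, hδ,
    map_leibnizDefect f hf]

end ProductDefect

/-! ### The restricted Poisson structure on the tensor product. -/

section TensorRestricted

variable {K : Type u} [Field K] {p : ℕ} [hpr : Fact p.Prime] [CharP K p] [hp : Fact (3 ≤ p)]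
  {A : Type v} [CommRing A] [Algebra K A] [PoissonAlgebra K A]
  {B : Type w} [CommRing B] [Algebra K B] [PoissonAlgebra K B]
  {α : A → A} {β : B → B} {γ : A ⊗[K] B → A ⊗[K] B}

/-- Biadditivity reduces the claim to pure tensors. These are products of elements of the two
factors, so the cocycle relation reduces it further to pairs from A ⊗ 1 and 1 ⊗ B. -/
theorem productDefect_tensor_eq_zero (hα : IsRestrictedPoissonStructure K p α)
    (hβ : IsRestrictedPoissonStructure K p β) (hγ : IsRestrictedLiePMap p (bracket (K := K)) γ)
    (h : ∀ a b, γ (a ⊗ₜ[K] b) = α a ⊗ₜ[K] (b ^ p) + (a ^ p) ⊗ₜ[K] β b) (x y : A ⊗[K] B) :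
    productDefect K p γ x y = 0 := by
  have hA : ∀ a a' : A, productDefect K p γ (a ⊗ₜ[K] (1 : B)) (a' ⊗ₜ[K] (1 : B)) = 0 := by
    intro a a'
    have := map_productDefect (K := K) (p := p) (γ := α) (δ := γ) _
      (includeLeft_bracket (A := A) (B := B)) (fun x => by simp [h, pmap_one hβ]) a a'
    rw [productDefect_eq_zero hα, map_zero] at this
    exact this.symm
  have hB : ∀ b b' : B, productDefect K p γ ((1 : A) ⊗ₜ[K] b) ((1 : A) ⊗ₜ[K] b') = 0 := by
    intro b b'
    have := map_productDefect (K := K) (p := p) (γ := β) (δ := γ) _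
      (includeRight_bracket (A := A) (B := B)) (fun x => by simp [h, pmap_one hα]) b b'
    rw [productDefect_eq_zero hβ, map_zero] at this
    exact this.symm
  have hAB : ∀ (a : A) (b : B), productDefect K p γ (a ⊗ₜ[K] (1 : B)) ((1 : A) ⊗ₜ[K] b) = 0 := by
    intro a b
    rw [productDefect, leibnizDefect_eq_zero (bracket_tmul_one_one_tmul a b)]
    simp [h, pmap_one hα, pmap_one hβ]
    ring
  have hBA : ∀ (a : A) (b : B), productDefect K p γ ((1 : A) ⊗ₜ[K] b) (a ⊗ₜ[K] (1 : B)) = 0 :=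
    fun a b => by rw [productDefect_comm, hAB]
  -- In each of the next cocycle relations the triple is chosen so that all terms but the wanted one
  -- are already known to vanish.
  have hA' : ∀ (a a' : A) (b : B), productDefect K p γ (a ⊗ₜ[K] (1 : B)) (a' ⊗ₜ[K] b) = 0 := by
    intro a a' b
    have := productDefect_cocycle (K := K) (p := p) (γ := γ) (a ⊗ₜ[K] (1 : B))
      (a' ⊗ₜ[K] (1 : B)) ((1 : A) ⊗ₜ[K] b)
    simpa [hA, hAB] using this
  have hB' : ∀ (a : A) (b b' : B), productDefect K p γ ((1 : A) ⊗ₜ[K] b) (a ⊗ₜ[K] b') = 0 := by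
    intro a b b'
    have := productDefect_cocycle (K := K) (p := p) (γ := γ) ((1 : A) ⊗ₜ[K] b)
      ((1 : A) ⊗ₜ[K] b') (a ⊗ₜ[K] (1 : B))
    simpa [hB, hBA] using this
  induction x with
  | zero => simp [productDefect, pmap_zero hγ, hpr.out.ne_zero, leibnizDefect_zero_left]
  | add x x' hx hx' => rw [productDefect_add_left hγ, hx, hx', add_zero]
  | tmul a b =>
    induction y with
    | zero => simp [productDefect, pmap_zero hγ, hpr.out.ne_zero, leibnizDefect_zero_right]
    | add y y' hy hy' => rw [productDefect_add_right hγ, hy, hy', add_zero]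
    | tmul a' b' =>
      have := productDefect_cocycle (K := K) (p := p) (γ := γ) (a ⊗ₜ[K] (1 : B))
        ((1 : A) ⊗ₜ[K] b) (a' ⊗ₜ[K] b')
      simpa [hA', hB', hAB] using this

theorem exists_isTensorPMap (hα : IsRestrictedPoissonStructure K p α)
    (hβ : IsRestrictedPoissonStructure K p β) :
    ∃ γ : A ⊗[K] B → A ⊗[K] B, IsTensorPMap K p α β γ := by
  obtain ⟨γ, hγ, h⟩ := exists_tensor_restrictedLie hα.isRestrictedLie hβ.isRestrictedLie
  refine ⟨γ, ⟨hγ, fun x => ?_⟩, h⟩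
  have := productDefect_tensor_eq_zero hα hβ hγ h x x
  rw [productDefect_self] at this
  exact sub_eq_zero.mp (eq_zero_of_two_mul (K := K) (p := p) this)

/-- Compatibility with `p`-maps need only be checked on pure tensors. -/
theorem map_pmap_of_tmul {M : Type*} [CommRing M] [Algebra K M] [PoissonAlgebra K M]
    {δ : M → M} (hγ : IsRestrictedLiePMap p (bracket (K := K)) γ)
    (hδ : IsRestrictedLiePMap p (bracket (K := K)) δ) (f : A ⊗[K] B →ₐ[K] M)
    (hf : ∀ x y, f (bracket (K := K) x y) = bracket (K := K) (f x) (f y))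
    (h : ∀ a b, f (γ (a ⊗ₜ b)) = δ (f (a ⊗ₜ b))) (x : A ⊗[K] B) : f (γ x) = δ (f x) := by
  induction x with
  | zero => rw [pmap_zero hγ, map_zero, pmap_zero hδ]
  | add x y hx hy =>
    rw [hγ.map_add, map_add, map_add, hx, hy, map_add, hδ.map_add, map_jacobsonLambda f hf]
  | tmul a b => exact h a b

theorem existsUnique_isTensorPMap (hα : IsRestrictedPoissonStructure K p α)
    (hβ : IsRestrictedPoissonStructure K p β) :
    ∃! γ : A ⊗[K] B → A ⊗[K] B, IsTensorPMap K p α β γ := by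
  obtain ⟨γ, hγ⟩ := exists_isTensorPMap hα hβ
  refine ⟨γ, hγ, fun γ' hγ' => funext fun x => ?_⟩
  exact map_pmap_of_tmul hγ'.isRestricted.isRestrictedLie hγ.isRestricted.isRestrictedLie
    (AlgHom.id K _) (fun _ _ => rfl) (fun a b => by simp [hγ.map_tmul, hγ'.map_tmul]) x

end TensorRestricted

end PoissonAlgebra

/-! ### Structure isomorphisms as morphisms of restricted Poisson algebras. -/

section RestrictedHoms

variable {K : Type u} [Field K] {p : ℕ}

theorem isRestrictedPoissonStructure_base [hpr : Fact p.Prime] :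
    IsRestrictedPoissonStructure K p (fun _ : K => (0 : K)) where
  isRestrictedLie :=
    { ad_pow x := by
        change (0 : Module.End K K) ^ p = 0
        exact zero_pow hpr.out.ne_zero
      map_smul c x := by simp
      map_add x y := by
        rw [jacobsonLambda_eq_zero _ hpr.out.two_le rfl rfl]
        simp }
  map_sq x := by simp

namespace IsRestrictedPoissonHom

variable {A : Type*} {B : Type*} [CommRing A] [Algebra K A] [PoissonAlgebra K A]
  [CommRing B] [Algebra K B] [PoissonAlgebra K B] {α : A → A} {β : B → B}

theorem symm {e : A ≃ₐ[K] B} (h : IsRestrictedPoissonHom K α β (e : A →ₐ[K] B)) :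
    IsRestrictedPoissonHom K β α (e.symm : B →ₐ[K] A) where
  map_bracket x y := e.injective <| by
    simpa using (h.map_bracket (e.symm x) (e.symm y)).symm
  map_pmap x := e.injective <| by simpa using (h.map_pmap (e.symm x)).symm

variable [hpr : Fact p.Prime] [CharP K p] [hp : Fact (3 ≤ p)]
  {C : Type*} {D : Type*} [CommRing C] [Algebra K C] [PoissonAlgebra K C]
  [CommRing D] [Algebra K D] [PoissonAlgebra K D] {γ : C → C} {δ : D → D}
  {ε : A ⊗[K] B → A ⊗[K] B} {ζ : C ⊗[K] D → C ⊗[K] D}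

theorem tensorMap (hε : IsTensorPMap K p α β ε) (hζ : IsTensorPMap K p γ δ ζ)
    {f : A →ₐ[K] C} {g : B →ₐ[K] D} (hf : IsRestrictedPoissonHom K α γ f)
    (hg : IsRestrictedPoissonHom K β δ g) :
    IsRestrictedPoissonHom K ε ζ (Algebra.TensorProduct.map f g) where
  map_bracket := PoissonAlgebra.tensorMap_bracket f g hf.map_bracket hg.map_bracket
  map_pmap := PoissonAlgebra.map_pmap_of_tmul hε.isRestricted.isRestrictedLie
    hζ.isRestricted.isRestrictedLie _
    (PoissonAlgebra.tensorMap_bracket f g hf.map_bracket hg.map_bracket)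
    fun a b => by simp [hε.map_tmul, hζ.map_tmul, hf.map_pmap, hg.map_pmap]

theorem tensorComm {ε' : B ⊗[K] A → B ⊗[K] A} (hε : IsTensorPMap K p α β ε)
    (hε' : IsTensorPMap K p β α ε') :
    IsRestrictedPoissonHom K ε ε' (Algebra.TensorProduct.comm K A B : A ⊗[K] B →ₐ[K] B ⊗[K] A) := by
  have hbr := PoissonAlgebra.map_bracket_of_tmul
    (Algebra.TensorProduct.comm K A B : A ⊗[K] B →ₐ[K] B ⊗[K] A).toLinearMap fun a b a' b' => by
      simp [PoissonAlgebra.bracket_tmul, add_comm]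
  exact ⟨hbr, PoissonAlgebra.map_pmap_of_tmul hε.isRestricted.isRestrictedLie
    hε'.isRestricted.isRestrictedLie _ hbr
    fun a b => by simp [hε.map_tmul, hε'.map_tmul, add_comm]⟩

/-- With zero `p`-map on K, the formula on c ⊗ a reduces to the p-semilinearity of α. -/
theorem tensorLid {ε : K ⊗[K] A → K ⊗[K] A} (hα : IsRestrictedPoissonStructure K p α)
    (hε : IsTensorPMap K p (fun _ : K => (0 : K)) α ε) :
    IsRestrictedPoissonHom K ε α (Algebra.TensorProduct.lid K A : K ⊗[K] A →ₐ[K] A) := by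
  have h0 : ∀ x y : K, PoissonAlgebra.bracket (K := K) x y = 0 := fun _ _ => rfl
  have hbr := PoissonAlgebra.map_bracket_of_tmul
    (Algebra.TensorProduct.lid K A : K ⊗[K] A →ₐ[K] A).toLinearMap fun a b a' b' => by
      simp [PoissonAlgebra.bracket_tmul, h0, smul_smul, mul_comm]
  exact ⟨hbr, PoissonAlgebra.map_pmap_of_tmul hε.isRestricted.isRestrictedLie
    hα.isRestrictedLie _ hbr
    fun a b => by simp [hε.map_tmul, hα.isRestrictedLie.map_smul]⟩

theorem tensorRid {ε : A ⊗[K] K → A ⊗[K] K} (hα : IsRestrictedPoissonStructure K p α)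
    (hε : IsTensorPMap K p α (fun _ : K => (0 : K)) ε) :
    IsRestrictedPoissonHom K ε α (Algebra.TensorProduct.rid K K A : A ⊗[K] K →ₐ[K] A) := by
  have h0 : ∀ x y : K, PoissonAlgebra.bracket (K := K) x y = 0 := fun _ _ => rfl
  have hbr := PoissonAlgebra.map_bracket_of_tmul
    (Algebra.TensorProduct.rid K K A : A ⊗[K] K →ₐ[K] A).toLinearMap fun a b a' b' => by
      simp [PoissonAlgebra.bracket_tmul, h0, smul_smul, mul_comm]
  exact ⟨hbr, PoissonAlgebra.map_pmap_of_tmul hε.isRestricted.isRestrictedLie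
    hα.isRestrictedLie _ hbr
    fun a b => by simp [hε.map_tmul, hα.isRestrictedLie.map_smul]⟩

theorem tensorAssoc {η : (A ⊗[K] B) ⊗[K] C → (A ⊗[K] B) ⊗[K] C} {θ : B ⊗[K] C → B ⊗[K] C}
    {κ : A ⊗[K] (B ⊗[K] C) → A ⊗[K] (B ⊗[K] C)} (hε : IsTensorPMap K p α β ε)
    (hη : IsTensorPMap K p ε γ η) (hθ : IsTensorPMap K p β γ θ) (hκ : IsTensorPMap K p α θ κ) :
    IsRestrictedPoissonHom K η κ (Algebra.TensorProduct.assoc K K K A B C :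
      (A ⊗[K] B) ⊗[K] C →ₐ[K] A ⊗[K] (B ⊗[K] C)) := by
  have hbr := PoissonAlgebra.map_bracket_of_tmul
    (Algebra.TensorProduct.assoc K K K A B C :
      (A ⊗[K] B) ⊗[K] C →ₐ[K] A ⊗[K] (B ⊗[K] C)).toLinearMap fun x c x' c' => by
      induction x with
      | zero => simp
      | add x y hx hy => simp only [TensorProduct.add_tmul, map_add, LinearMap.add_apply, hx, hy]
      | tmul a b =>
        induction x' with
        | zero => simp
        | add x y hx hy => simp only [TensorProduct.add_tmul, map_add, hx, hy]
        | tmul a' b' =>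
          simp [PoissonAlgebra.bracket_tmul, TensorProduct.add_tmul, TensorProduct.tmul_add,
            add_assoc]
  refine ⟨hbr, PoissonAlgebra.map_pmap_of_tmul hη.isRestricted.isRestrictedLie
    hκ.isRestricted.isRestrictedLie _ hbr fun x c => ?_⟩
  have hη0 := PoissonAlgebra.pmap_zero hη.isRestricted.isRestrictedLie
  have hκ0 := PoissonAlgebra.pmap_zero hκ.isRestricted.isRestrictedLie
  -- The first factor need not be pure, so a second induction is needed; on triple tensors both
  -- sides are the same sum of three terms.
  induction x with
  | zero => simp [hη0, hκ0]
  | add x y hx hy =>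
    rw [TensorProduct.add_tmul, hη.isRestricted.isRestrictedLie.map_add, map_add, map_add, hx, hy,
      map_add, hκ.isRestricted.isRestrictedLie.map_add,
      PoissonAlgebra.map_jacobsonLambda _ hbr]
  | tmul a b =>
    simp [hη.map_tmul, hκ.map_tmul, hε.map_tmul, hθ.map_tmul, TensorProduct.add_tmul,
      TensorProduct.tmul_add, add_assoc]

end IsRestrictedPoissonHom

end RestrictedHoms

/-! ### The symmetric monoidal category. -/

namespace RestrictedPoissonCat

variable {K : Type u} [Field K] {p : ℕ}

/-- Reduces every coherence law to the one for commutative algebras. -/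
instance : (forgetPoisson K p).Faithful where
  map_injective h := Hom.ext (congrArg CommAlgCat.Hom.hom h)

/-- The isomorphism given by an algebra isomorphism that is a morphism. -/
def isoMk {X Y : RestrictedPoissonCat K p} (e : X.carrier ≃ₐ[K] Y.carrier)
    (h : IsRestrictedPoissonHom K X.pmap Y.pmap (e : X.carrier →ₐ[K] Y.carrier)) : X ≅ Y where
  hom := ⟨e, h⟩
  inv := ⟨e.symm, h.symm⟩
  hom_inv_id := Hom.ext (AlgHom.ext e.symm_apply_apply)
  inv_hom_id := Hom.ext (AlgHom.ext e.apply_symm_apply)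

variable [hpr : Fact p.Prime] [CharP K p] [hp : Fact (3 ≤ p)]

/-- The `p`-map of the tensor product. -/
noncomputable def tensorPMap (X Y : RestrictedPoissonCat K p) :
    X.carrier ⊗[K] Y.carrier → X.carrier ⊗[K] Y.carrier :=
  (PoissonAlgebra.exists_isTensorPMap X.isRestricted Y.isRestricted).choose

theorem isTensorPMap (X Y : RestrictedPoissonCat K p) :
    IsTensorPMap K p X.pmap Y.pmap (tensorPMap X Y) :=
  (PoissonAlgebra.exists_isTensorPMap X.isRestricted Y.isRestricted).choose_spec

variable (K p) in
/-- The base field as a restricted Poisson algebra. -/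
noncomputable abbrev unitObj : RestrictedPoissonCat K p :=
  ⟨K, fun _ => 0, isRestrictedPoissonStructure_base⟩

/-- The tensor product of restricted Poisson algebras. -/
noncomputable abbrev prodObj (X Y : RestrictedPoissonCat K p) : RestrictedPoissonCat K p :=
  ⟨X.carrier ⊗[K] Y.carrier, tensorPMap X Y, (isTensorPMap X Y).isRestricted⟩

/-- The tensor product of morphisms. -/
noncomputable abbrev prodMap {X X' Y Y' : RestrictedPoissonCat K p} (f : X ⟶ X') (g : Y ⟶ Y') :
    prodObj X Y ⟶ prodObj X' Y' :=
  ⟨Algebra.TensorProduct.map f.toAlgHom g.toAlgHom,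
    .tensorMap (isTensorPMap _ _) (isTensorPMap _ _) f.isHom g.isHom⟩

variable (K p) in
/-- The tensor product, unit and structure isomorphisms of restricted Poisson algebras. -/
noncomputable abbrev tensorStruct : MonoidalCategoryStruct (RestrictedPoissonCat K p) where
  tensorObj := prodObj
  whiskerLeft X _ _ f := prodMap (𝟙 X) f
  whiskerRight f Y := prodMap f (𝟙 Y)
  tensorHom f g := prodMap f g
  tensorUnit := unitObj K p
  associator X Y Z := isoMk (Algebra.TensorProduct.assoc K K K X.carrier Y.carrier Z.carrier)
    (.tensorAssoc (isTensorPMap X Y) (isTensorPMap (prodObj X Y) Z) (isTensorPMap Y Z)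
      (isTensorPMap X (prodObj Y Z)))
  leftUnitor X := isoMk (X := prodObj (unitObj K p) X) (Algebra.TensorProduct.lid K X.carrier)
    (.tensorLid X.isRestricted (isTensorPMap (unitObj K p) X))
  rightUnitor X := isoMk (X := prodObj X (unitObj K p)) (Algebra.TensorProduct.rid K K X.carrier)
    (.tensorRid X.isRestricted (isTensorPMap X (unitObj K p)))

section

attribute [local instance] tensorStruct

variable (K p) in
/-- All structure isomorphisms are those of the underlying algebras. -/
noncomputable def inducingFunctorData : Monoidal.InducingFunctorData (forgetPoisson K p) where
  μIso X Y := Iso.refl (CommAlgCat.of K (X.carrier ⊗[K] Y.carrier))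
  εIso := Iso.refl (CommAlgCat.of K K)
  whiskerLeft_eq _ _ _ _ := rfl
  whiskerRight_eq _ _ := rfl
  tensorHom_eq _ _ := rfl
  associator_eq X Y Z := by
    let A := CommAlgCat.of K X.carrier
    let B := CommAlgCat.of K Y.carrier
    let C := CommAlgCat.of K Z.carrier
    -- All comparison maps are identities, so the required equation is this one up to definitional
    -- unfolding.
    have h : (𝟙 _ ≫ (𝟙 (tensorObj A B) ⊗ₘ 𝟙 C)) ≫ (α_ A B C).hom ≫
        (𝟙 A ⊗ₘ 𝟙 (tensorObj B C)) ≫ 𝟙 _ = (α_ A B C).hom := by simp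
    exact h.symm
  leftUnitor_eq X := by
    let A := CommAlgCat.of K X.carrier
    have h : (𝟙 _ ≫ (𝟙 (𝟙_ (CommAlgCat K)) ⊗ₘ 𝟙 A)) ≫ (λ_ A).hom = (λ_ A).hom := by simp
    exact h.symm
  rightUnitor_eq X := by
    let A := CommAlgCat.of K X.carrier
    have h : (𝟙 _ ≫ (𝟙 A ⊗ₘ 𝟙 (𝟙_ (CommAlgCat K)))) ≫ (ρ_ A).hom = (ρ_ A).hom := by simp
    exact h.symm

variable (K p) in
/-- The monoidal category of restricted Poisson algebras. -/
noncomputable abbrev monoidalCategory : MonoidalCategory (RestrictedPoissonCat K p) :=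
  Monoidal.induced (forgetPoisson K p) (inducingFunctorData K p)

end

section

attribute [local instance] monoidalCategory

variable (K p) in
/-- The forgetful functor is strong monoidal. -/
noncomputable abbrev forgetMonoidal : (forgetPoisson K p).Monoidal :=
  letI := tensorStruct K p
  Monoidal.fromInducedMonoidal (forgetPoisson K p) (inducingFunctorData K p)

attribute [local instance] forgetMonoidal

variable (K p) in
/-- The symmetry of restricted Poisson algebras. -/
noncomputable abbrev braidedCategory : BraidedCategory (RestrictedPoissonCat K p) :=
  .ofFaithful (forgetPoisson K p)
    (fun X Y => isoMk (X := prodObj X Y) (Y := prodObj Y X)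
      (Algebra.TensorProduct.comm K X.carrier Y.carrier)
      (.tensorComm (isTensorPMap X Y) (isTensorPMap Y X)))
    fun _ _ => rfl

attribute [local instance] braidedCategory

variable (K p) in
/-- The forgetful functor is braided. -/
noncomputable abbrev forgetBraided : (forgetPoisson K p).Braided where
  braided _ _ := rfl

/-- The category of commutative algebras is symmetric. -/
noncomputable instance commAlgCatSymmetric : SymmetricCategory (CommAlgCat.{u} K) where
  symmetry X Y := CommAlgCat.hom_ext <| AlgHom.ext fun x =>
    (Algebra.TensorProduct.comm K X Y).symm_apply_apply x

attribute [local instance] forgetBraided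

variable (K p) in
/-- The category of restricted Poisson algebras is symmetric. -/
noncomputable abbrev symmetricCategory : SymmetricCategory (RestrictedPoissonCat K p) :=
  .ofFaithful (forgetPoisson K p)

theorem isRestrictedPoissonHom_comparison (X Y : RestrictedPoissonCat K p) :
    IsRestrictedPoissonHom K (tensorPMap X Y) (X ⊗ Y).pmap (comparison X Y) :=
  ⟨fun _ _ => rfl, fun _ => rfl⟩

end

end RestrictedPoissonCat

theorem proposition9p2 {K : Type u} [Field K] {p : ℕ} [Fact p.Prime] [CharP K p] (hp : 3 ≤ p) :
    -- existence and uniqueness of the tensor product structure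
    (∀ (A : Type v) (B : Type w) [CommRing A] [Algebra K A] [PoissonAlgebra K A]
      [CommRing B] [Algebra K B] [PoissonAlgebra K B] (α : A → A) (β : B → B),
      IsRestrictedPoissonStructure K p α → IsRestrictedPoissonStructure K p β →
        ∃! γ : A ⊗[K] B → A ⊗[K] B, IsTensorPMap K p α β γ) ∧
    -- with this tensor product, restricted Poisson algebras form a symmetric monoidal category;
    -- all coherence isomorphisms are those of the underlying commutative algebras
    (∃ (_ : MonoidalCategory (RestrictedPoissonCat K p))
      (_ : SymmetricCategory (RestrictedPoissonCat K p))
      (_ : (RestrictedPoissonCat.forgetPoisson K p).Braided),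
      ∀ X Y : RestrictedPoissonCat K p,
        ∃ γ : X.carrier ⊗[K] Y.carrier → X.carrier ⊗[K] Y.carrier,
          IsTensorPMap K p X.pmap Y.pmap γ ∧
          IsRestrictedPoissonHom K γ (X ⊗ Y).pmap
            (RestrictedPoissonCat.comparison X Y)) ∧
    -- being a restricted Poisson Hopf algebra is well defined: it refers to the one structure
    -- on the tensor square
    (∀ (H : Type v) [CommRing H] [HopfAlgebra K H] [PoissonAlgebra K H] (γ : H → H),
      IsRestrictedPoissonStructure K p γ →
        ∃! δ : H ⊗[K] H → H ⊗[K] H, IsTensorPMap K p γ γ δ ∧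
          (IsRestrictedPoissonHopf K p γ ↔
            IsRestrictedPoissonHom K γ δ (Bialgebra.comulAlgHom K H) ∧
            IsRestrictedPoissonHom K γ (fun _ : K => (0 : K)) (Bialgebra.counitAlgHom K H) ∧
            IsRestrictedPoissonAntiAut K γ (HopfAlgebra.antipode K (A := H)))) := by
  have : Fact (3 ≤ p) := ⟨hp⟩
  refine ⟨fun A B _ _ _ _ _ _ α β hα hβ => PoissonAlgebra.existsUnique_isTensorPMap hα hβ,
    ⟨RestrictedPoissonCat.monoidalCategory K p, RestrictedPoissonCat.symmetricCategory K p,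
      RestrictedPoissonCat.forgetBraided K p, fun X Y =>
      ⟨RestrictedPoissonCat.tensorPMap X Y, RestrictedPoissonCat.isTensorPMap X Y,
        RestrictedPoissonCat.isRestrictedPoissonHom_comparison X Y⟩⟩, fun H _ _ _ γ hγ => ?_⟩
  obtain ⟨δ, hδ, huniq⟩ := PoissonAlgebra.existsUnique_isTensorPMap hγ hγ
  refine ⟨δ, ⟨hδ, fun h => ⟨?_, h.counit, h.antipode⟩, fun ⟨h₁, h₂, h₃⟩ =>
    ⟨hγ, ⟨δ, hδ, h₁⟩, h₂, h₃⟩⟩, fun δ' hδ' => huniq δ' hδ'.1⟩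
  -- The Hopf condition supplies some tensor `p`-map δ'; uniqueness identifies it with δ.
  obtain ⟨δ', hδ', h'⟩ := h.comul
  exact huniq δ' hδ' ▸ h'
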